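/- An embedding of a finite poset $\mathcal Q=(Q,\le^Q)$ into a finite poset $\mathcal P=(P,\le^P)$ is an injective map $e:Q\to P$ such that $q\le^Q q'$ if and only if $e(q)\le^P e(q')$ for all $q,q'\in Q$; the width of $\mathcal P$ is the maximum cardinality of an antichain of $\mathcal P$. The problem Embedding asks, given $\mathcal Q$ and $\mathcal P$, whether there is an embedding of $\mathcal Q$ into $\mathcal P$. Embedding can be solved in time $O\big(\mathrm{width}(\mathcal P)^{|Q|}\cdot|Q|^3\cdot|P|^2\big)$. Precisely: there are one word RAM program and constants $c,C\in\mathbb N$ such that, for all finite posets $\mathcal Q,\mathcal P$, given by $|Q|$, $|P|$ and the 0/1 matrices of $\le^Q$ and $\le^P$ with respect to arbitrary numberings of their elements, and for every word length $b$ with $2^b\ge c\,(|Q|+|P|+1)^2$, the program, run on a machine with $b$-bit words, halts without overflow after at most $$C\cdot\max\big\{1,\ \mathrm{width}(\mathcal P)^{|Q|}\cdot|Q|^3\cdot|P|^2\big\}$$ steps and outputs $1$ if there is an embedding of $\mathcal Q$ into $\mathcal P$ and $0$ otherwise. (The maximum with $1$ matters only when $Q$ or $P$ is empty.) A step is one elementary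 operation: assigning a constant or a copy, addition, truncated subtraction or multiplication of two words, an indirect memory read or write, or a comparison of two registers; the program is built from these by sequencing, branching and while loops. -/

import Mathlib

open Classical in
/-- The width of a finite poset: the maximum cardinality of an antichain. -/
noncomputable def posetWidth (P : Type*) [Fintype P] [PartialOrder P] : ℕ :=
  (Finset.univ.filter (fun A : Finset P => IsAntichain (· ≤ ·) (A : Set P))).sup Finset.card

namespace WordRAM

/-- A configuration of the word RAM: registers (a program mentions only finitely many of them)
and a random access memory. -/
structure State where
  reg : ℕ → ℕ
  mem : ℕ → ℕ

/-- The elementary instructions; all arguments except the `v` of `const` are register names. -/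
inductive Instr where
  /-- `d := v` -/
  | const (d v : ℕ)
  /-- `d := a` -/
  | copy (d a : ℕ)
  /-- `d := a + a'` -/
  | add (d a a' : ℕ)
  /-- `d := max (a - a') 0` -/
  | sub (d a a' : ℕ)
  /-- `d := a * a'` -/
  | mul (d a a' : ℕ)
  /-- `d := mem[a]` -/
  | load (d a : ℕ)
  /-- `mem[a] := s` -/
  | store (a s : ℕ)

/-- Comparison of two registers. -/
inductive Test where
  | lt (a a' : ℕ)
  | eq (a a' : ℕ)

/-- Programs: elementary instructions combined by structured control flow. -/
inductive Prog where
  | skip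
  | instr (i : Instr)
  | seq (p q : Prog)
  | ite (c : Test) (p q : Prog)
  | loop (c : Test) (p : Prog)

/-- Write `v` into register `d`; the machine has `b`-bit words, and a value that does not fit
into a word is an error (`none`). -/
def State.setReg (b : ℕ) (s : State) (d v : ℕ) : Option State :=
  if v < 2 ^ b then some { s with reg := Function.update s.reg d v } else none

/-- Effect of one elementary instruction on a machine with `b`-bit words. -/
def Instr.step (b : ℕ) (s : State) : Instr → Option State
  | .const d v => s.setReg b d v
  | .copy d a => s.setReg b d (s.reg a)
  | .add d a a' => s.setReg b d (s.reg a + s.reg a')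
  | .sub d a a' => s.setReg b d (s.reg a - s.reg a')
  | .mul d a a' => s.setReg b d (s.reg a * s.reg a')
  | .load d a => s.setReg b d (s.mem (s.reg a))
  | .store a r => some { s with mem := Function.update s.mem (s.reg a) (s.reg r) }

/-- Truth of a test in a configuration. -/
def Test.Holds (s : State) : Test → Prop
  | .lt a a' => s.reg a < s.reg a'
  | .eq a a' => s.reg a = s.reg a'

/-- `Exec b p s s' t`: on a machine with `b`-bit words the program `p`, started in the
configuration `s`, halts without error in the configuration `s'` after exactly `t` steps. Every
elementary instruction and every evaluation of a test is one step. -/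
inductive Exec (b : ℕ) : Prog → State → State → ℕ → Prop where
  | skip (s : State) : Exec b .skip s s 1
  | instr {i : Instr} {s s' : State} (h : i.step b s = some s') : Exec b (.instr i) s s' 1
  | seq {p q : Prog} {s s' s'' : State} {t t' : ℕ}
      (hp : Exec b p s s' t) (hq : Exec b q s' s'' t') : Exec b (.seq p q) s s'' (t + t')
  | ite_true {c : Test} {p q : Prog} {s s' : State} {t : ℕ}
      (hc : c.Holds s) (hp : Exec b p s s' t) : Exec b (.ite c p q) s s' (t + 1)
  | ite_false {c : Test} {p q : Prog} {s s' : State} {t : ℕ}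
      (hc : ¬ c.Holds s) (hq : Exec b q s s' t) : Exec b (.ite c p q) s s' (t + 1)
  | loop_done {c : Test} {p : Prog} {s : State}
      (hc : ¬ c.Holds s) : Exec b (.loop c p) s s 1
  | loop_step {c : Test} {p : Prog} {s s' s'' : State} {t t' : ℕ}
      (hc : c.Holds s) (hp : Exec b p s s' t) (hl : Exec b (.loop c p) s' s'' t') :
      Exec b (.loop c p) s s'' (t + 1 + t')

/-- Runs are deterministic: final configuration and number of steps are determined. -/
theorem Exec.deterministic {b : ℕ} {p : Prog} {s s₁ s₂ : State} {t₁ t₂ : ℕ}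
    (h₁ : Exec b p s s₁ t₁) (h₂ : Exec b p s s₂ t₂) : s₁ = s₂ ∧ t₁ = t₂ := by
  induction h₁ generalizing s₂ t₂ with
  | skip s => cases h₂; exact ⟨rfl, rfl⟩
  | instr h => cases h₂ with
    | instr h' => exact ⟨Option.some.inj (h.symm.trans h'), rfl⟩
  | seq _ _ ihp ihq => cases h₂ with
    | seq hp' hq' =>
      obtain ⟨rfl, rfl⟩ := ihp hp'
      obtain ⟨rfl, rfl⟩ := ihq hq'
      exact ⟨rfl, rfl⟩
  | ite_true hc _ ih => cases h₂ with
    | ite_true _ hp' => obtain ⟨rfl, rfl⟩ := ih hp'; exact ⟨rfl, rfl⟩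
    | ite_false hc' _ => exact absurd hc hc'
  | ite_false hc _ ih => cases h₂ with
    | ite_true hc' _ => exact absurd hc' hc
    | ite_false _ hq' => obtain ⟨rfl, rfl⟩ := ih hq'; exact ⟨rfl, rfl⟩
  | loop_done hc => cases h₂ with
    | loop_done _ => exact ⟨rfl, rfl⟩
    | loop_step hc' _ _ => exact absurd hc' hc
  | loop_step hc _ _ ihp ihl => cases h₂ with
    | loop_done hc' => exact absurd hc hc'
    | loop_step _ hp' hl' =>
      obtain ⟨rfl, rfl⟩ := ihp hp'
      obtain ⟨rfl, rfl⟩ := ihl hl'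
      exact ⟨rfl, rfl⟩

open Classical in
/-- The initial configuration for a pair of finite posets whose elements are numbered by `eQ` and
`eP`: register 0 holds `k = |Q|`, register 1 holds `n = |P|`, and the memory holds the 0/1-matrix
of the order of `Q` (row by row, at addresses `0, …, k² - 1`) followed by the 0/1-matrix of the
order of `P` (row by row, at addresses `k², …, k² + n² - 1`). Everything else is 0. -/
noncomputable def posetPairInput {Q P : Type*} [Fintype Q] [PartialOrder Q]
    [Fintype P] [PartialOrder P]
    (eQ : Fin (Fintype.card Q) ≃ Q) (eP : Fin (Fintype.card P) ≃ P) : State where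
  reg := fun r =>
    if r = 0 then Fintype.card Q else if r = 1 then Fintype.card P else 0
  mem := fun a =>
    if (∃ i j : Fin (Fintype.card Q),
          a = (i : ℕ) * Fintype.card Q + j ∧ eQ i ≤ eQ j) ∨
       (∃ i j : Fin (Fintype.card P),
          a = Fintype.card Q * Fintype.card Q + (i : ℕ) * Fintype.card P + j ∧ eP i ≤ eP j)
    then 1 else 0

end WordRAM

/-!
First `P` is partitioned into at most `width P` chains, one element at a time. The new element is a
chain of its own, one pointer climbs each chain, and a pointer that lies below another pointer moves
up. If the pointers become an antichain, their number is at most the width. If instead a pointer has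
to leave the top of its chain, the recorded reasons of the moves lead from there back to the bottom
of a chain along an alternating path, as in the proof of Dilworth's theorem, and exchanging the
links along this path saves one chain.

Every copy of `Q` in `P` places each element of `Q` on one of the chains, which leaves at most
`width P ^ |Q|` cases. In each case start with a pointer at the bottom of the chosen chain for every
element of `Q`. If two pointers violate the order of `Q`, then one of them has to move up in order
to reach a copy above the pointers, so this move does not pass any such copy. Hence the pointers
stop at the least copy of `Q` on these chains, or one of them runs out of its chain and there is
none. There are at most `|Q| * |P|` moves, and each is found in `O(|Q| ^ 2)` steps.
-/

namespace PosetEmbedding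

open WordRAM

/-! ### Chains and exchanges -/

/-- The elements below `X` without a predecessor link: the least elements of the chains described
by `prd`. Throughout, the number `N` in place of an element means "no element". -/
def bottoms (N : ℕ) (prd : ℕ → ℕ) (X : ℕ) : Finset ℕ := {y ∈ Finset.range X | prd y = N}

/-- The links `prd` and `nxt` describe a partition of the elements below `X` into `lt`-chains,
except that the successor link of `u` may be out of date, `u` being the top of its chain;
`u = N` means that there is no exception. -/
structure Links (lt : ℕ → ℕ → Prop) (N : ℕ) (prd nxt : ℕ → ℕ) (X u : ℕ) : Prop where
  of_prd : ∀ y < X, prd y = N ∨ prd y < X ∧ prd y ≠ u ∧ nxt (prd y) = y ∧ lt (prd y) y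
  of_nxt : ∀ z < X, z ≠ u → nxt z = N ∨ nxt z < X ∧ prd (nxt z) = z

/-- The element `z` can be linked to the larger element `wit z`, whose predecessor, if there is
one, is in `L` and hence can be linked to another element in turn. -/
structure ExchangeStep (lt : ℕ → ℕ → Prop) (N : ℕ) (prd wit : ℕ → ℕ) (X z : ℕ) (L : List ℕ) :
    Prop where
  lt_bound : z < X
  notMem : z ∉ L
  wit_lt_bound : wit z < X
  lt_wit : lt z (wit z)
  prd_wit : prd (wit z) = N ∨ prd (wit z) ∈ L

/-- Every element of the list is the start of an exchange that continues in the rest of the list.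
These are the alternating paths of the bipartite matching behind Dilworth's theorem. -/
inductive Exchange (lt : ℕ → ℕ → Prop) (N : ℕ) (prd wit : ℕ → ℕ) (X : ℕ) : List ℕ → Prop
  | nil : Exchange lt N prd wit X []
  | cons {z : ℕ} {L : List ℕ} (head : ExchangeStep lt N prd wit X z L)
      (tail : Exchange lt N prd wit X L) : Exchange lt N prd wit X (z :: L)

/-- One pointer climbs each chain, and `L` lists the elements that have been passed: each of them
starts an exchange. -/
structure Search (lt : ℕ → ℕ → Prop) (N : ℕ) (prd wit : ℕ → ℕ) (X m : ℕ) (ptr : ℕ → ℕ)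
    (L : List ℕ) : Prop where
  lt_bound : ∀ q < m, ptr q < X
  injOn : Set.InjOn ptr (Set.Iio m)
  notMem : ∀ q < m, ptr q ∉ L
  prd_ptr : ∀ q < m, prd (ptr q) = N ∨ prd (ptr q) ∈ L
  prd_mem : ∀ z ∈ L, prd z = N ∨ prd z ∈ L
  exchange : Exchange lt N prd wit X L

section Chains

variable {lt : ℕ → ℕ → Prop} {N X m u v w y z : ℕ} {prd nxt wit bot ptr : ℕ → ℕ} {L : List ℕ}

theorem mem_bottoms : y ∈ bottoms N prd X ↔ y < X ∧ prd y = N := by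
  simp [bottoms]

theorem bottoms_succ_of_eq (hX : prd X = N) :
    bottoms N prd (X + 1) = insert X (bottoms N prd X) := by
  rw [bottoms, Finset.range_add_one, Finset.filter_insert, if_pos hX, bottoms]

theorem bottoms_succ_of_ne (hX : prd X ≠ N) : bottoms N prd (X + 1) = bottoms N prd X := by
  rw [bottoms, Finset.range_add_one, Finset.filter_insert, if_neg hX, bottoms]

theorem bottoms_congr {prd' : ℕ → ℕ} (h : ∀ y < X, prd' y = prd y) :
    bottoms N prd' X = bottoms N prd X :=
  Finset.filter_congr fun y hy => by rw [h y (Finset.mem_range.1 hy)]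

theorem card_bottoms_insert :
    (bottoms N (Function.update prd X N) (X + 1)).card = (bottoms N prd X).card + 1 := by
  rw [bottoms_succ_of_eq (by simp), Finset.card_insert_of_notMem (by simp [mem_bottoms]),
    bottoms_congr fun y hy => Function.update_of_ne hy.ne _ _]

theorem card_bottoms_relink (hy : y < X) (hu : u ≠ N) :
    (bottoms N (Function.update prd y u) X).card + (if prd y = N then 1 else 0) =
      (bottoms N prd X).card := by
  have erase : bottoms N (Function.update prd y u) X = (bottoms N prd X).erase y := by
    ext z
    rcases eq_or_ne z y with rfl | hzy <;> simp [mem_bottoms, *]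
  rw [erase]
  split_ifs with hp
  · exact Finset.card_erase_add_one (mem_bottoms.2 ⟨hy, hp⟩)
  · rw [Finset.erase_eq_of_notMem fun h => hp (mem_bottoms.1 h).2, Nat.add_zero]

theorem bijOn_bottoms_update (hbot : Set.BijOn bot (Set.Iio m) (bottoms N prd X))
    (hX : prd X = N) :
    Set.BijOn (Function.update bot m X) (Set.Iio (m + 1)) (bottoms N prd (X + 1)) := by
  have hm : Set.Iio (m + 1) = insert m (Set.Iio m) := Order.Iio_succ_eq_insert m
  have hbot' : Set.BijOn (Function.update bot m X) (Set.Iio m) (bottoms N prd X) :=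
    hbot.congr fun q hq => (Function.update_of_ne (ne_of_lt hq) _ _).symm
  have hnew : Function.update bot m X m ∉ bottoms N prd X := by simp [mem_bottoms]
  simpa [hm, bottoms_succ_of_eq hX] using hbot'.insert hnew

theorem card_eq_of_bijOn_bottoms (hbot : Set.BijOn bot (Set.Iio m) (bottoms N prd X)) :
    m = (bottoms N prd X).card := by
  simpa using hbot.ncard_eq

theorem le_of_bijOn_bottoms (hbot : Set.BijOn bot (Set.Iio m) (bottoms N prd X)) : m ≤ X := by
  rw [card_eq_of_bijOn_bottoms hbot]
  simpa [bottoms] using Finset.card_filter_le (Finset.range X) fun y => prd y = N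

theorem Links.insert (hL : Links lt N prd nxt X N) :
    Links lt N (Function.update prd X N) (Function.update nxt X N) (X + 1) N where
  of_prd y hy := by
    rcases eq_or_ne y X with rfl | hyX
    · simp
    · have := hL.of_prd y (by omega)
      grind
  of_nxt z hz hzN := by
    rcases eq_or_ne z X with rfl | hzX
    · simp
    · have := hL.of_nxt z (by omega) hzN
      grind

theorem Links.dangling (hL : Links lt N prd nxt X N) (hX : X ≤ N) (hu : nxt u = N) :
    Links lt N prd nxt X u where
  of_prd y hy := by
    have := hL.of_prd y hy
    grind
  of_nxt z hz _ := hL.of_nxt z hz (by omega)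

theorem Links.relink (hL : Links lt N prd nxt X u) (hX : X ≤ N) (hu : u < X) (hy : y < X)
    (huy : lt u y) : Links lt N (Function.update prd y u) (Function.update nxt u y) X (prd y) where
  of_prd z hz := by
    have hprd_y := hL.of_prd y hy
    have hprd_z := hL.of_prd z hz
    grind
  of_nxt z hz hzy := by
    have := hL.of_nxt z hz
    grind

theorem Exchange.head (hL : Exchange lt N prd wit X (z :: L)) :
    ExchangeStep lt N prd wit X z L := by
  cases hL
  assumption

theorem Exchange.tail (hL : Exchange lt N prd wit X (z :: L)) : Exchange lt N prd wit X L := by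
  cases hL
  assumption

theorem Exchange.lt_bound (hL : Exchange lt N prd wit X L) : ∀ z ∈ L, z < X := by
  induction hL with
  | nil => simp
  | cons head _ ih => simpa using ⟨head.lt_bound, ih⟩

theorem Exchange.nodup (hL : Exchange lt N prd wit X L) : L.Nodup := by
  induction hL with
  | nil => exact List.nodup_nil
  | cons head _ ih => exact List.nodup_cons.2 ⟨head.notMem, ih⟩

theorem Exchange.length_le (hL : Exchange lt N prd wit X L) : L.length ≤ X := by
  have := hL.nodup.subperm (l₂ := List.range X) fun z hz => List.mem_range.2 (hL.lt_bound z hz)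
  simpa using this.length_le

theorem Exchange.update_wit (hL : Exchange lt N prd wit X L) (hu : u ∉ L) :
    Exchange lt N prd (Function.update wit u y) X L := by
  induction hL with
  | nil => exact .nil
  | @cons z L head _ ih =>
    simp only [List.mem_cons, not_or] at hu
    have hz : Function.update wit u y z = wit z := Function.update_of_ne (Ne.symm hu.1) _ _
    exact .cons ⟨head.lt_bound, head.notMem, hz ▸ head.wit_lt_bound, hz ▸ head.lt_wit,
      hz ▸ head.prd_wit⟩ (ih hu.2)

theorem Exchange.update_prd (hL : Exchange lt N prd wit X L) (hy : prd y ∉ L.tail)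
    (hN : prd y ≠ N) : Exchange lt N (Function.update prd y u) wit X L := by
  induction hL with
  | nil => exact .nil
  | @cons z L head _ ih =>
    rw [List.tail_cons] at hy
    have hz : Function.update prd y u (wit z) = prd (wit z) := by
      have := head.prd_wit
      grind
    exact .cons ⟨head.lt_bound, head.notMem, head.wit_lt_bound, head.lt_wit, hz ▸ head.prd_wit⟩
      (ih fun h => hy (List.mem_of_mem_tail h))

theorem Exchange.exists_suffix (hL : Exchange lt N prd wit X L) (hz : z ∈ L) :
    ∃ L', Exchange lt N prd wit X (z :: L') ∧ L'.length < L.length := by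
  induction hL with
  | nil => simp at hz
  | @cons a L head tail ih =>
    rcases List.mem_cons.1 hz with rfl | hz
    · exact ⟨L, .cons head tail, by simp⟩
    · obtain ⟨L', h, hlen⟩ := ih hz
      exact ⟨L', h, by simp; omega⟩

theorem Search.of_bijOn (hbot : Set.BijOn bot (Set.Iio m) (bottoms N prd X))
    (hptr : ∀ q < m, ptr q = bot q) : Search lt N prd wit X m ptr [] where
  lt_bound q hq := hptr q hq ▸ (mem_bottoms.1 (hbot.mapsTo hq)).1
  injOn := hbot.injOn.congr fun q hq => (hptr q hq).symm
  notMem := by simp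
  prd_ptr q hq := .inl (hptr q hq ▸ (mem_bottoms.1 (hbot.mapsTo hq)).2)
  prd_mem := by simp
  exchange := .nil

theorem Search.exchange_cons (hS : Search lt N prd wit X m ptr L) (hv : v < m) (hw : w < m)
    (hvw : lt (ptr v) (ptr w)) :
    Exchange lt N prd (Function.update wit (ptr v) (ptr w)) X (ptr v :: L) :=
  .cons ⟨hS.lt_bound v hv, hS.notMem v hv, by simpa using hS.lt_bound w hw, by simpa using hvw,
    by simpa using hS.prd_ptr w hw⟩ (hS.exchange.update_wit (hS.notMem v hv))

theorem Search.advance [Std.Irrefl lt] (hS : Search lt N prd wit X m ptr L) (hX : X ≤ N)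
    (hlinks : Links lt N prd nxt X N) (hv : v < m) (hw : w < m) (hvw : lt (ptr v) (ptr w))
    (hN : nxt (ptr v) ≠ N) :
    Search lt N prd (Function.update wit (ptr v) (ptr w)) X m
      (Function.update ptr v (nxt (ptr v))) (ptr v :: L) := by
  obtain ⟨nxt_lt, prd_nxt⟩ :=
    (hlinks.of_nxt _ (hS.lt_bound v hv) (by have := hS.lt_bound v hv; omega)).resolve_left hN
  have prd_nxt_ne : ptr v ≠ N := by have := hS.lt_bound v hv; omega
  have : nxt (ptr v) ≠ ptr v := by
    intro h
    have := hlinks.of_prd _ (hS.lt_bound v hv)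
    have := irrefl_of lt (ptr v)
    grind
  have : nxt (ptr v) ∉ L := fun h => by
    have := hS.prd_mem _ h
    have := hS.notMem v hv
    grind
  have nxt_ne_ptr : ∀ q < m, ptr q ≠ nxt (ptr v) := fun q hq h => by
    have := hS.prd_ptr q hq
    have := hS.notMem v hv
    grind
  have inj : ∀ q < m, q ≠ v → ptr q ≠ ptr v := fun q hq h e => h (hS.injOn hq hv e)
  refine ⟨fun q hq => ?_, fun q hq q' hq' => ?_, fun q hq => ?_, fun q hq => ?_,
    fun z hz => ?_, hS.exchange_cons hv hw hvw⟩
  · have := hS.lt_bound q hq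
    grind
  · have : ptr q = ptr q' → q = q' := hS.injOn hq hq'
    have := nxt_ne_ptr q hq
    have := nxt_ne_ptr q' hq'
    grind
  · have := hS.notMem q hq
    have := inj q hq
    grind
  · have := hS.prd_ptr q hq
    grind
  · have := hS.prd_mem z
    have := hS.prd_ptr v hv
    grind

end Chains

/-! ### Forced moves -/

/-- The strict part of a partial order. -/
def StrictPart (le : ℕ → ℕ → Prop) (x y : ℕ) : Prop := le x y ∧ x ≠ y

instance (le : ℕ → ℕ → Prop) : Std.Irrefl (StrictPart le) := ⟨fun _ h => h.2 rfl⟩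

/-- The antichains of elements below `N` have at most `W` elements. -/
def WidthLE (le : ℕ → ℕ → Prop) (N W : ℕ) : Prop :=
  ∀ A : Finset ℕ, (∀ z ∈ A, z < N) → IsAntichain le (A : Set ℕ) → A.card ≤ W

/-- `s` maps the relation `R` on the numbers below `l` onto the relation that `le` induces on the
image. -/
def Realizes (le R : ℕ → ℕ → Prop) (l : ℕ) (s : ℕ → ℕ) : Prop :=
  ∀ q < l, ∀ q' < l, R q q' ↔ le (s q) (s q')

/-- The pointers `v` and `w` violate the relation `R` in such a way that `ptr v` has to move up in
every realization above the present pointers. -/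
def Forced (le R : ℕ → ℕ → Prop) (l : ℕ) (ptr : ℕ → ℕ) (v w : ℕ) : Prop :=
  v < l ∧ w < l ∧
    (¬ R v w ∧ le (ptr v) (ptr w) ∨ R w v ∧ ¬ le (ptr w) (ptr v))

/-- `z'` is reached from `z` by following successor links. -/
def Reach (N : ℕ) (nxt : ℕ → ℕ) : ℕ → ℕ → Prop :=
  Relation.ReflTransGen fun z z' => nxt z = z' ∧ z' < N

open Classical in
/-- The number of elements below `N` that are above `z` in the order `le`. -/
noncomputable def height (le : ℕ → ℕ → Prop) (N z : ℕ) : ℕ := {y ∈ Finset.range N | le z y}.card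

/-- `J r ptr wit` is preserved by forced moves along the links `nxt` that record their reason in
`wit`, and at most `r` such moves are possible. -/
structure AdvanceInvariant (le R : ℕ → ℕ → Prop) (N l : ℕ) (nxt : ℕ → ℕ)
    (J : ℕ → (ℕ → ℕ) → (ℕ → ℕ) → Prop) : Prop where
  ptr_lt {r : ℕ} {ptr wit : ℕ → ℕ} (hJ : J r ptr wit) : ∀ q < l, ptr q < N
  move {r v w : ℕ} {ptr wit : ℕ → ℕ} (hJ : J r ptr wit) (hF : Forced le R l ptr v w)
    (hnxt : nxt (ptr v) ≠ N) :
    ∃ r' < r, J r' (Function.update ptr v (nxt (ptr v))) (Function.update wit (ptr v) (ptr w))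

section PartialOrder

variable {le R : ℕ → ℕ → Prop} {N X W l m v w z z' : ℕ} {prd nxt bot ptr s : ℕ → ℕ}

theorem height_le : height le N z ≤ N := by
  classical
  simpa [height] using Finset.card_filter_le (Finset.range N) fun y => le z y

theorem sum_height_update_lt (hv : v < l) (h : height le N z < height le N (ptr v)) :
    ∑ q ∈ Finset.range l, height le N (Function.update ptr v z q) <
      ∑ q ∈ Finset.range l, height le N (ptr q) := by
  refine Finset.sum_lt_sum (fun q _ => ?_) ⟨v, by simpa using hv, by simpa using h⟩
  rcases eq_or_ne q v with rfl | hq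
  · simpa using h.le
  · rw [Function.update_of_ne hq]

theorem sum_height_le : ∑ q ∈ Finset.range l, height le N (ptr q) ≤ l * N := by
  simpa using Finset.sum_le_card_nsmul (Finset.range l) (fun q => height le N (ptr q)) N
    fun q _ => height_le

theorem Links.lt_nxt {lt : ℕ → ℕ → Prop} (hL : Links lt N prd nxt X N) (hX : X ≤ N) (hz : z < X)
    (hn : nxt z ≠ N) : nxt z < X ∧ lt z (nxt z) := by
  obtain ⟨hlt, hprd⟩ := (hL.of_nxt z hz (by omega)).resolve_left hn
  have := hL.of_prd _ hlt
  grind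

theorem Reach.nxt_of_ne (h : Reach N nxt z z') (hne : z ≠ z') :
    nxt z < N ∧ Reach N nxt (nxt z) z' := by
  rcases h.cases_head with h | ⟨y, ⟨rfl, hy⟩, h⟩
  · exact absurd h hne
  · exact ⟨hy, h⟩

section Refl

variable [Std.Refl le]

theorem Forced.strictPart (hF : Forced le Eq l ptr v w) (hptr : Set.InjOn ptr (Set.Iio l)) :
    StrictPart le (ptr v) (ptr w) := by
  obtain ⟨hv, hw, ⟨hne, hle⟩ | ⟨rfl, hle⟩⟩ := hF
  · exact ⟨hle, fun h => hne (hptr hv hw h)⟩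
  · exact absurd (refl_of le _) hle

theorem Realizes.le_of_widthLE (hs : Realizes le Eq m s) (hW : WidthLE le N W)
    (hsN : ∀ q < m, s q < N) : m ≤ W := by
  have hinj : Set.InjOn s (Finset.range m) := fun q hq q' hq' h =>
    (hs q (by simpa using hq) q' (by simpa using hq')).2 (h ▸ refl_of le _)
  calc m = ((Finset.range m).image s).card := by
        rw [Finset.card_image_of_injOn hinj, Finset.card_range]
    _ ≤ W := by
        refine hW _ (by simpa using hsN) ?_
        rintro _ hx _ hy hne hle
        obtain ⟨q, hq, rfl⟩ := by simpa using hx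
        obtain ⟨q', hq', rfl⟩ := by simpa using hy
        exact hne (congrArg s ((hs q hq q' hq').2 hle))

theorem Search.advanceInvariant (hX : X ≤ N) (hL : Links (StrictPart le) N prd nxt X N) :
    AdvanceInvariant le Eq N m nxt fun r ptr wit =>
      ∃ L : List ℕ, r + L.length = X ∧ Search (StrictPart le) N prd wit X m ptr L where
  ptr_lt := by
    rintro r ptr wit ⟨L, -, hS⟩ q hq
    exact (hS.lt_bound q hq).trans_le hX
  move := by
    rintro r v w ptr wit ⟨L, hr, hS⟩ hF hnxt
    have hS' := hS.advance hX hL hF.1 hF.2.1 (hF.strictPart hS.injOn) hnxt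
    have := hS'.exchange.length_le
    rw [List.length_cons] at this
    exact ⟨r - 1, by omega, _, by rw [List.length_cons]; omega, hS'⟩

end Refl

section Preorder

variable [IsPreorder ℕ le]

theorem le_of_reach (hL : Links (StrictPart le) N prd nxt N N) (h : Reach N nxt z z') (hz : z < N) :
    le z z' := by
  suffices z' < N ∧ le z z' from this.2
  induction h with
  | refl => exact ⟨hz, refl_of le z⟩
  | tail _ h ih =>
    obtain ⟨rfl, hlt⟩ := h
    exact ⟨hlt, _root_.trans ih.2 (hL.lt_nxt le_rfl ih.1 hlt.ne).2.1⟩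

theorem Forced.reach (hF : Forced le R l ptr v w) (hL : Links (StrictPart le) N prd nxt N N)
    (hptr : ∀ q < l, ptr q < N) (hs : Realizes le R l s)
    (hreach : ∀ q < l, Reach N nxt (ptr q) (s q)) :
    nxt (ptr v) < N ∧ Reach N nxt (nxt (ptr v)) (s v) := by
  obtain ⟨hv, hw, hF⟩ := hF
  refine (hreach v hv).nxt_of_ne fun heq => ?_
  have ptr_w_le : le (ptr w) (s w) := le_of_reach hL (hreach w hw) (hptr w hw)
  rcases hF with ⟨hR, hle⟩ | ⟨hR, hle⟩
  · exact hR ((hs v hv w hw).2 (heq ▸ _root_.trans hle ptr_w_le))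
  · exact hle (heq ▸ _root_.trans ptr_w_le ((hs w hw v hv).1 hR))

end Preorder

variable [IsPartialOrder ℕ le]

theorem height_lt_height (hz : z < N) (h : StrictPart le z z') :
    height le N z' < height le N z := by
  classical
  refine Finset.card_lt_card ((Finset.ssubset_iff_of_subset ?_).2 ⟨z, ?_, ?_⟩)
  · exact Finset.monotone_filter_right _ fun y _ => _root_.trans h.1
  · simpa using ⟨hz, refl_of le z⟩
  · simpa using fun _ h' => h.2 (antisymm h.1 h')

theorem exists_reach_of_bijOn (hL : Links (StrictPart le) N prd nxt N N)
    (hbot : Set.BijOn bot (Set.Iio m) (bottoms N prd N)) (hz : z < N) :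
    ∃ q < m, Reach N nxt (bot q) z := by
  induction hd : height (Function.swap le) N z using Nat.strong_induction_on generalizing z with
  | _ d ih =>
    subst hd
    rcases hL.of_prd z hz with h | ⟨prd_lt, -, nxt_prd, hlt⟩
    · obtain ⟨q, hq, rfl⟩ := hbot.surjOn (mem_bottoms.2 ⟨hz, h⟩)
      exact ⟨q, hq, .refl⟩
    · obtain ⟨q, hq, hr⟩ := ih _ (height_lt_height hz ⟨hlt.1, hlt.2.symm⟩) prd_lt rfl
      exact ⟨q, hq, hr.tail ⟨nxt_prd, hz⟩⟩

theorem pos_of_bijOn_bottoms (hL : Links (StrictPart le) N prd nxt N N)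
    (hbot : Set.BijOn bot (Set.Iio m) (bottoms N prd N)) (hN : 0 < N) : 0 < m :=
  have ⟨_, hq, _⟩ := exists_reach_of_bijOn hL hbot hN
  Nat.zero_lt_of_lt hq

theorem Reach.advanceInvariant (hL : Links (StrictPart le) N prd nxt N N) (ptr₀ : ℕ → ℕ) :
    AdvanceInvariant le R N l nxt fun r ptr _ =>
      (∀ q < l, ptr q < N) ∧ ∑ q ∈ Finset.range l, height le N (ptr q) ≤ r ∧
        ∀ s, Realizes le R l s → (∀ q < l, Reach N nxt (ptr₀ q) (s q)) →
          ∀ q < l, Reach N nxt (ptr q) (s q) where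
  ptr_lt hJ := hJ.1
  move := by
    rintro r v w ptr - ⟨hptr, hr, hreach⟩ hF hnxt
    obtain ⟨nxt_lt, hlt⟩ := hL.lt_nxt le_rfl (hptr v hF.1) hnxt
    have hsum := sum_height_update_lt hF.1 (height_lt_height (hptr v hF.1) hlt)
    refine ⟨_, hsum.trans_le hr, fun q hq => ?_, le_rfl, fun s hs hs₀ q hq => ?_⟩
    · rcases eq_or_ne q v with rfl | hqv
      · rwa [Function.update_self]
      · rw [Function.update_of_ne hqv]
        exact hptr q hq
    · rcases eq_or_ne q v with rfl | hqv
      · rw [Function.update_self]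
        exact (hF.reach hL hptr hs (hreach s hs hs₀)).2
      · rw [Function.update_of_ne hqv]
        exact hreach s hs hs₀ q hq

end PartialOrder

/-! ### Digits -/

/-- The digits of `M` in base `m` are `dig 0, …, dig (K - 1)`, the least significant one first. -/
def Digits (m K M : ℕ) (dig : ℕ → ℕ) : Prop := ∀ q < K, dig q = M / m ^ q % m

theorem exists_digits {m K : ℕ} {f : ℕ → ℕ} (hf : ∀ q < K, f q < m) :
    ∃ M < m ^ K, Digits m K M f := by
  induction K generalizing f with
  | zero => exact ⟨0, by simp, by simp [Digits]⟩
  | succ K ih =>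
    obtain ⟨M, hM, hd⟩ := ih fun q hq => hf (q + 1) (Nat.succ_lt_succ hq)
    have h0 : f 0 < m := hf 0 K.succ_pos
    refine ⟨f 0 + m * M, ?_, ?_⟩
    · rw [pow_succ']
      nlinarith
    · rintro (_ | q) hq
      · simp [Nat.mod_eq_of_lt h0]
      · have hfq : f (q + 1) = M / m ^ q % m := hd q (Nat.lt_of_succ_lt_succ hq)
        rw [hfq, pow_succ', ← Nat.div_div_eq_div_mul,
          Nat.add_mul_div_left _ _ (by omega), Nat.div_eq_of_lt h0, Nat.zero_add]

theorem carry_step {m M i c : ℕ} (hm : 0 < m) (hc : c ≤ 1)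
    (h : (M + 1) / m ^ i = M / m ^ i + c) :
    (M + 1) / m ^ i % m = (if M / m ^ i % m + c < m then M / m ^ i % m + c else 0) ∧
      (M + 1) / m ^ (i + 1) =
        M / m ^ (i + 1) + (if M / m ^ i % m + c < m then 0 else 1) := by
  rw [pow_succ, ← Nat.div_div_eq_div_mul, ← Nat.div_div_eq_div_mul, h]
  generalize M / m ^ i = a
  have hlt : a % m < m := Nat.mod_lt a hm
  have hc' : a + c = a % m + c + m * (a / m) := by have := Nat.mod_add_div a m; omega
  rw [hc', Nat.add_mul_mod_self_left, Nat.add_mul_div_left _ _ hm]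
  split_ifs with hd
  · simp [Nat.mod_eq_of_lt hd, Nat.div_eq_of_lt hd]
  · have : a % m + c = m := by omega
    rw [this, Nat.mod_self, Nat.div_self hm, Nat.add_comm]
    exact ⟨rfl, rfl⟩

theorem carry_eq_one_iff {m K M c : ℕ} (hm : 0 < m) (hM : M < m ^ K)
    (h : (M + 1) / m ^ K = M / m ^ K + c) : c = 1 ↔ M + 1 = m ^ K := by
  rw [Nat.div_eq_of_lt hM, Nat.zero_add] at h
  subst h
  constructor
  · intro h
    by_contra hne
    rw [Nat.div_eq_of_lt (by omega)] at h
    omega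
  · rintro h
    rw [h, Nat.div_self (Nat.pow_pos hm)]

/-! ### Machine states -/

/-- The variables of the programs below, held in registers from `7` on. -/
inductive Var where
  | x | m | l | lim | i | j | v | w | t | u | y | rel | found | active | carry | more | res
  deriving DecidableEq

/-- The arrays of the programs below, stored interleaved behind the input: `prd` and `nxt` hold the
links of the chains, `bot` their least elements, `ptr` the pointers that climb the chains, `wit` the
reasons of the moves, and `dig` the chain chosen for each element of `Q`. -/
inductive Arr where
  | prd | nxt | ptr | wit | bot | dig
  deriving DecidableEq

/-- What an instruction may read: a variable, or one of the constants `k = |Q|`, `n = |P|` and `1`,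
which the machine holds in the registers `0`, `1` and `6`. -/
inductive Operand where
  | var (z : Var) | k | n | one
  deriving DecidableEq

instance : Coe Var Operand := ⟨.var⟩

/-- The register that holds a variable. -/
def Var.reg (z : Var) : ℕ := 7 + z.ctorIdx

/-- The register that holds an operand. -/
def Operand.reg : Operand → ℕ
  | var z => z.reg
  | k => 0
  | n => 1
  | one => 6

theorem Var.ctorIdx_injective : Function.Injective Var.ctorIdx :=
  Function.LeftInverse.injective Var.ofNat_ctorIdx

theorem Arr.ctorIdx_injective : Function.Injective Arr.ctorIdx :=
  Function.LeftInverse.injective Arr.ofNat_ctorIdx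

theorem Arr.ctorIdx_lt (r : Arr) : r.ctorIdx < 8 := by
  cases r <;> decide

/-- An abstract machine state: the values of the variables and the entries of the arrays. -/
structure Store where
  var : Var → ℕ
  arr : Arr → ℕ → ℕ

namespace Store

/-- Assign a value to a variable. -/
def set (h : Store) (d : Var) (e : ℕ) : Store := { h with var := Function.update h.var d e }

/-- Assign a value to an array entry. -/
def setArr (h : Store) (r : Arr) (i e : ℕ) : Store :=
  { h with arr := Function.update h.arr r (Function.update (h.arr r) i e) }

variable (h : Store) (d z : Var) (r r' : Arr) (i e : ℕ)

@[simp]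
theorem var_set : (h.set d e).var z = if z = d then e else h.var z :=
  Function.update_apply h.var d e z

theorem arr_setArr (i' : ℕ) :
    (h.setArr r i e).arr r' i' = if r' = r ∧ i' = i then e else h.arr r' i' := by
  by_cases hr : r' = r
  · subst hr
    simp [setArr, Function.update_apply]
  · simp [setArr, hr]

end Store

/-- The relations `qle` on the numbers below `K = |Q|` and `le` on the numbers below `N = |P|`,
given to a machine with `b`-bit words that are long enough for all addresses that occur. -/
structure Input where
  b : ℕ
  K : ℕ
  N : ℕ
  qle : ℕ → ℕ → Prop
  le : ℕ → ℕ → Prop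
  word : 16 * (K + N + 1) ^ 2 ≤ 2 ^ b

section Programs

variable {I : Input} {h h' : Store} {s : State}

/-- The first address behind the two matrices of the input. -/
def Input.base (I : Input) : ℕ := I.K * I.K + I.N * I.N

/-- The largest value that a variable or an array entry takes. -/
def Input.bound (I : Input) : ℕ := I.K + I.N + 1

theorem Input.lt_word {e : ℕ} (he : e < 16 * (I.K + I.N + 1) ^ 2) : e < 2 ^ I.b :=
  he.trans_le I.word

theorem Input.lt_word_of_le_bound {e : ℕ} (he : e ≤ I.bound) : e < 2 ^ I.b := by
  apply I.lt_word
  unfold bound at he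
  nlinarith

theorem Input.eight_lt_word : 8 < 2 ^ I.b := by
  have : 0 < (I.K + I.N + 1) ^ 2 := by positivity
  exact I.lt_word (by omega)

theorem Input.base_lt_word : I.base < 2 ^ I.b := by
  apply I.lt_word
  unfold base
  nlinarith

theorem Input.address_lt_word {i : ℕ} (hi : i ≤ I.bound) (r : Arr) :
    I.base + 8 * i + r.ctorIdx < 2 ^ I.b := by
  have := r.ctorIdx_lt
  apply I.lt_word
  unfold base
  unfold bound at hi
  nlinarith

/-- The value of an operand in an abstract state. -/
def Operand.val (I : Input) (h : Store) : Operand → ℕ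
  | var z => h.var z
  | k => I.K
  | n => I.N
  | one => 1

theorem Operand.val_var (z : Var) : (var z).val I h = h.var z := rfl

theorem Operand.val_one : one.val I h = 1 := rfl

open Classical in
/-- The machine configuration `s` represents the abstract state `h`. -/
structure Sim (I : Input) (h : Store) (s : State) : Prop where
  reg_operand (a : Operand) : s.reg a.reg = a.val I h
  reg_four : s.reg 4 = I.K * I.K
  reg_five : s.reg 5 = I.base
  mem_arr (r : Arr) (i : ℕ) : s.mem (I.base + 8 * i + r.ctorIdx) = h.arr r i
  mem_qle : ∀ i < I.K, ∀ j < I.K, s.mem (i * I.K + j) = if I.qle i j then 1 else 0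
  mem_le : ∀ i < I.N, ∀ j < I.N, s.mem (I.K * I.K + i * I.N + j) = if I.le i j then 1 else 0
  var_le (z : Var) : h.var z ≤ I.bound
  arr_le (r : Arr) (i : ℕ) : h.arr r i ≤ I.bound

theorem Operand.reg_notMem_scratch (a : Operand) : a.reg ∉ ({2, 3, 4, 5} : Finset ℕ) := by
  cases a <;> simp [reg, Var.reg]; omega

theorem Operand.reg_ne (a : Operand) (z : Var) (h : a ≠ z) : a.reg ≠ z.reg := by
  rcases a with z' | _ | _ | _
  · exact fun e => h (congrArg _ (Var.ctorIdx_injective (by simp only [reg, Var.reg] at e; omega)))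
  all_goals simp only [reg, Var.reg]; omega

theorem Operand.val_le (hs : Sim I h s) (a : Operand) : a.val I h ≤ I.bound := by
  cases a
  · exact hs.var_le _
  all_goals simp only [val, Input.bound]; omega

theorem Operand.val_set {d : Var} {e : ℕ} (a : Operand) :
    a.val I (h.set d e) = if a = d then e else a.val I h := by
  cases a <;> simp [val]

theorem Sim.set_scratch (hs : Sim I h s) {r : ℕ} (hr : r = 2 ∨ r = 3) (e : ℕ) :
    Sim I h { s with reg := Function.update s.reg r e } :=
  { hs with
    reg_operand a := by
      have := a.reg_notMem_scratch
      rw [← hs.reg_operand a]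
      exact Function.update_of_ne (by rintro rfl; grind) _ _
    reg_four := by rw [← hs.reg_four]; exact Function.update_of_ne (by omega) _ _
    reg_five := by rw [← hs.reg_five]; exact Function.update_of_ne (by omega) _ _ }

theorem Sim.set (hs : Sim I h s) (d : Var) {e : ℕ} (he : e ≤ I.bound) :
    Sim I (h.set d e) { s with reg := Function.update s.reg d.reg e } where
  reg_operand a := by
    rw [Operand.val_set]
    split_ifs with ha
    · subst ha
      exact Function.update_self ..
    · rw [← hs.reg_operand a]
      exact Function.update_of_ne (a.reg_ne d ha) _ _
  reg_four := by
    rw [← hs.reg_four]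
    exact Function.update_of_ne (by simp only [Var.reg]; omega) _ _
  reg_five := by
    rw [← hs.reg_five]
    exact Function.update_of_ne (by simp only [Var.reg]; omega) _ _
  mem_arr := hs.mem_arr
  mem_qle := hs.mem_qle
  mem_le := hs.mem_le
  var_le z := by
    rw [Store.var_set]
    split_ifs
    exacts [he, hs.var_le z]
  arr_le := hs.arr_le

theorem Sim.setArr (hs : Sim I h s) (r : Arr) (i : ℕ) {e : ℕ} (he : e ≤ I.bound) :
    Sim I (h.setArr r i e)
      { s with mem := Function.update s.mem (I.base + 8 * i + r.ctorIdx) e } where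
  reg_operand a := by
    rw [hs.reg_operand a]
    cases a <;> rfl
  reg_four := hs.reg_four
  reg_five := hs.reg_five
  mem_arr r' i' := by
    have := r.ctorIdx_lt
    have := r'.ctorIdx_lt
    have := @Arr.ctorIdx_injective r r'
    have := hs.mem_arr r' i'
    grind [Function.update_apply, Store.arr_setArr]
  mem_qle i' hi' j' hj' := by
    rw [← hs.mem_qle i' hi' j' hj']
    have : i' * I.K + j' < I.K * I.K := by nlinarith
    exact Function.update_of_ne (by unfold Input.base; omega) _ _
  mem_le i' hi' j' hj' := by
    rw [← hs.mem_le i' hi' j' hj']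
    have : i' * I.N + j' < I.N * I.N := by nlinarith
    exact Function.update_of_ne (by unfold Input.base; omega) _ _
  var_le := hs.var_le
  arr_le r' i' := by
    rw [Store.arr_setArr]
    split_ifs
    exacts [he, hs.arr_le r' i']

/-! ### Program logic -/

/-- A program together with the variables and the arrays that it may change. -/
structure Cmd where
  prog : Prog
  vars : List Var
  arrs : List Arr

/-- A comparison of two operands. -/
inductive Cond where
  | lt (a a' : Operand)
  | eq (a a' : Operand)

/-- The test of the machine that implements a comparison. -/
def Cond.toTest : Cond → Test
  | lt a a' => .lt a.reg a'.reg
  | eq a a' => .eq a.reg a'.reg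

/-- A comparison is true in an abstract state. -/
def Cond.Holds (I : Input) (h : Store) : Cond → Prop
  | lt a a' => a.val I h < a'.val I h
  | eq a a' => a.val I h = a'.val I h

namespace Cmd

/-- The empty program. -/
def skip : Cmd := ⟨.skip, [], []⟩

/-- Sequential composition. -/
def seq (p q : Cmd) : Cmd := ⟨.seq p.prog q.prog, p.vars ∪ q.vars, p.arrs ∪ q.arrs⟩

/-- Branching. -/
def ite (c : Cond) (p q : Cmd) : Cmd :=
  ⟨.ite c.toTest p.prog q.prog, p.vars ∪ q.vars, p.arrs ∪ q.arrs⟩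

/-- The while loop. -/
def loop (c : Cond) (p : Cmd) : Cmd := ⟨.loop c.toTest p.prog, p.vars, p.arrs⟩

/-- `d := e` for a constant `e` -/
def assign (d : Var) (e : ℕ) : Cmd := ⟨.instr (.const d.reg e), [d], []⟩

/-- `d := a` -/
def move (d : Var) (a : Operand) : Cmd := ⟨.instr (.copy d.reg a.reg), [d], []⟩

/-- `d := a + a'` -/
def add (d : Var) (a a' : Operand) : Cmd := ⟨.instr (.add d.reg a.reg a'.reg), [d], []⟩

/-- Compute the address of an array entry in register `2`. -/
def address (r : Arr) (a : Operand) : Prog :=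
  .seq (.instr (.const 2 8)) (.seq (.instr (.mul 2 2 a.reg)) (.seq (.instr (.add 2 2 5))
    (.seq (.instr (.const 3 r.ctorIdx)) (.instr (.add 2 2 3)))))

/-- `d := r[a]` -/
def fetch (d : Var) (r : Arr) (a : Operand) : Cmd :=
  ⟨.seq (address r a) (.instr (.load d.reg 2)), [d], []⟩

/-- `r[a] := a'` -/
def write (r : Arr) (a a' : Operand) : Cmd :=
  ⟨.seq (address r a) (.instr (.store 2 a'.reg)), [], [r]⟩

/-- `d := 1` if `a ≤ a'` in `Q`, and `d := 0` otherwise -/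
def fetchQ (d : Var) (a a' : Operand) : Cmd :=
  ⟨.seq (.instr (.mul 2 a.reg Operand.k.reg)) (.seq (.instr (.add 2 2 a'.reg))
    (.instr (.load d.reg 2))), [d], []⟩

/-- `d := 1` if `a ≤ a'` in `P`, and `d := 0` otherwise -/
def fetchP (d : Var) (a a' : Operand) : Cmd :=
  ⟨.seq (.instr (.mul 2 a.reg Operand.n.reg)) (.seq (.instr (.add 2 2 4))
    (.seq (.instr (.add 2 2 a'.reg)) (.instr (.load d.reg 2)))), [d], []⟩

end Cmd

infixr:60 " ⨾ " => Cmd.seq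

/-- Only the variables in `V` and the arrays in `A` differ between the two states. -/
structure Frame (V : List Var) (A : List Arr) (h h' : Store) : Prop where
  var_of_notMem : ∀ z ∉ V, h'.var z = h.var z
  arr_of_notMem : ∀ r ∉ A, h'.arr r = h.arr r

/-- Started in `h`, the program `p` halts in a state and after a number of steps that satisfy
`Post`. -/
def Sat (I : Input) (p : Cmd) (h : Store) (Post : Store → ℕ → Prop) : Prop :=
  ∀ s, Sim I h s → ∃ s' t h', Exec I.b p.prog s s' t ∧ Sim I h' s' ∧
    Frame p.vars p.arrs h h' ∧ Post h' t

section Rules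

variable {p q : Cmd} {c : Cond} {Post Post' : Store → ℕ → Prop} {d : Var} {r : Arr}
  {a a' : Operand} {h'' : Store} {V V' : List Var} {A A' : List Arr}

theorem Frame.refl (h : Store) : Frame V A h h :=
  ⟨fun _ _ => rfl, fun _ _ => rfl⟩

theorem Frame.trans (hF : Frame V A h h') (hF' : Frame V A h' h'') : Frame V A h h'' :=
  ⟨fun z hz => (hF'.var_of_notMem z hz).trans (hF.var_of_notMem z hz),
    fun r hr => (hF'.arr_of_notMem r hr).trans (hF.arr_of_notMem r hr)⟩

theorem Frame.union_left (hF : Frame V A h h') : Frame (V ∪ V') (A ∪ A') h h' :=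
  ⟨fun z hz => hF.var_of_notMem z (mt (List.mem_union_left · _) hz),
    fun r hr => hF.arr_of_notMem r (mt (List.mem_union_left · _) hr)⟩

theorem Frame.union_right (hF : Frame V' A' h h') : Frame (V ∪ V') (A ∪ A') h h' :=
  ⟨fun z hz => hF.var_of_notMem z (mt (List.mem_union_right _) hz),
    fun r hr => hF.arr_of_notMem r (mt (List.mem_union_right _) hr)⟩

theorem Frame.set (hd : d ∈ V) (e : ℕ) : Frame V A h (h.set d e) :=
  ⟨fun z hz => Function.update_of_ne (by rintro rfl; exact hz hd) _ _, fun _ _ => rfl⟩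

theorem Frame.setArr (hr : r ∈ A) (i e : ℕ) : Frame V A h (h.setArr r i e) :=
  ⟨fun _ _ => rfl, fun r' hr' => Function.update_of_ne (by rintro rfl; exact hr' hr) _ _⟩

theorem Frame.var (hF : Frame V A h h') (z : Var) (hz : z ∉ V := by exact of_decide_eq_true rfl) :
    h'.var z = h.var z :=
  hF.var_of_notMem z hz

theorem Frame.arr (hF : Frame V A h h') (r : Arr) (hr : r ∉ A := by exact of_decide_eq_true rfl) :
    h'.arr r = h.arr r :=
  hF.arr_of_notMem r hr

theorem Frame.val (hF : Frame V A h h') (ha : a ∉ V.map Operand.var) :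
    a.val I h' = a.val I h := by
  cases a with
  | var z => exact hF.var z fun hz => ha (List.mem_map_of_mem hz)
  | _ => rfl

theorem Cond.holds_toTest (hs : Sim I h s) : c.toTest.Holds s ↔ c.Holds I h := by
  cases c <;> simp [toTest, Test.Holds, Holds, hs.reg_operand]

theorem exec_setReg {b dst e : ℕ} {i : Instr} (hi : i.step b s = s.setReg b dst e)
    (he : e < 2 ^ b) :
    Exec b (.instr i) s { s with reg := Function.update s.reg dst e } 1 :=
  .instr (hi.trans (if_pos he))

theorem Sim.exec_scratch (hs : Sim I h s) {dst e : ℕ} {i : Instr} (hdst : dst = 2 ∨ dst = 3)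
    (hi : i.step I.b s = s.setReg I.b dst e) (he : e < 2 ^ I.b) :
    ∃ s', Exec I.b (.instr i) s s' 1 ∧ Sim I h s' ∧ s'.reg dst = e ∧
      ∀ r ≠ dst, s'.reg r = s.reg r :=
  ⟨_, exec_setReg hi he, hs.set_scratch hdst e, Function.update_self .., fun _ hr =>
    Function.update_of_ne hr ..⟩

theorem Sim.exec_address (hs : Sim I h s) (r : Arr) (a : Operand) :
    ∃ s', Exec I.b (Cmd.address r a) s s' 5 ∧ Sim I h s' ∧
      s'.reg 2 = I.base + 8 * a.val I h + r.ctorIdx := by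
  have hlt := I.address_lt_word (a.val_le hs) r
  obtain ⟨s₁, e₁, hs₁, r₁, -⟩ := hs.exec_scratch (i := .const 2 8) (.inl rfl) rfl
    I.eight_lt_word
  obtain ⟨s₂, e₂, hs₂, r₂, -⟩ := hs₁.exec_scratch (i := .mul 2 2 a.reg) (e := 8 * a.val I h)
    (.inl rfl) (by simp only [Instr.step, r₁, hs₁.reg_operand]) (by omega)
  obtain ⟨s₃, e₃, hs₃, r₃, -⟩ := hs₂.exec_scratch (i := .add 2 2 5) (e := 8 * a.val I h + I.base)
    (.inl rfl) (by simp only [Instr.step, r₂, hs₂.reg_five]) (by omega)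
  obtain ⟨s₄, e₄, hs₄, r₄, o₄⟩ := hs₃.exec_scratch (i := .const 3 r.ctorIdx) (.inr rfl) rfl
    (by omega)
  obtain ⟨s₅, e₅, hs₅, r₅, -⟩ := hs₄.exec_scratch (i := .add 2 2 3)
    (e := I.base + 8 * a.val I h + r.ctorIdx) (.inl rfl)
    (by simp only [Instr.step, r₄, o₄ 2 (by decide), r₃, Nat.add_comm]) hlt
  exact ⟨s₅, .seq e₁ (.seq e₂ (.seq e₃ (.seq e₄ e₅))), hs₅, r₅⟩

theorem Sim.exec_set (hs : Sim I h s) {e : ℕ} {i : Instr} (d : Var) (he : e ≤ I.bound)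
    (hi : i.step I.b s = s.setReg I.b d.reg e) :
    ∃ s', Exec I.b (.instr i) s s' 1 ∧ Sim I (h.set d e) s' :=
  ⟨_, exec_setReg hi (I.lt_word_of_le_bound he), hs.set d he⟩

theorem Sat.imp (hp : Sat I p h Post)
    (hPost : ∀ h' t, Frame p.vars p.arrs h h' → Post h' t → Post' h' t) : Sat I p h Post' := by
  intro s hs
  obtain ⟨s', t, h', e, hs', hF, hP⟩ := hp s hs
  exact ⟨s', t, h', e, hs', hF, hPost h' t hF hP⟩

theorem Sat.of_bounds (hp : (∀ a : Operand, a.val I h ≤ I.bound) → Sat I p h Post) :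
    Sat I p h Post :=
  fun s hs => hp (Operand.val_le hs) s hs

theorem sat_skip (hPost : Post h 1) : Sat I .skip h Post :=
  fun s hs => ⟨s, 1, h, .skip s, hs, .refl h, hPost⟩

theorem sat_assign {e : ℕ} (he : e ≤ 1) (hPost : Post (h.set d e) 1) :
    Sat I (.assign d e) h Post := by
  intro s hs
  obtain ⟨s', e, hs'⟩ := hs.exec_set (i := .const d.reg e) d (by unfold Input.bound; omega) rfl
  exact ⟨s', 1, _, e, hs', .set (List.mem_singleton_self d) _, hPost⟩

theorem sat_move (hPost : Post (h.set d (a.val I h)) 1) : Sat I (.move d a) h Post := by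
  intro s hs
  obtain ⟨s', e, hs'⟩ := hs.exec_set (i := .copy d.reg a.reg) d (a.val_le hs)
    (by simp only [Instr.step, hs.reg_operand])
  exact ⟨s', 1, _, e, hs', .set (List.mem_singleton_self d) _, hPost⟩

theorem sat_add (hle : a.val I h + a'.val I h ≤ I.bound)
    (hPost : Post (h.set d (a.val I h + a'.val I h)) 1) : Sat I (.add d a a') h Post := by
  intro s hs
  obtain ⟨s', e, hs'⟩ := hs.exec_set (i := .add d.reg a.reg a'.reg) d hle
    (by simp only [Instr.step, hs.reg_operand])
  exact ⟨s', 1, _, e, hs', .set (List.mem_singleton_self d) _, hPost⟩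

theorem sat_fetch (hPost : Post (h.set d (h.arr r (a.val I h))) 6) :
    Sat I (.fetch d r a) h Post := by
  intro s hs
  obtain ⟨s₁, e₁, hs₁, r₁⟩ := hs.exec_address r a
  obtain ⟨s₂, e₂, hs₂⟩ := hs₁.exec_set (i := .load d.reg 2) d (hs₁.arr_le r (a.val I h))
    (by simp only [Instr.step, r₁, hs₁.mem_arr])
  exact ⟨s₂, 6, _, .seq e₁ e₂, hs₂, .set (List.mem_singleton_self d) _, hPost⟩

theorem sat_write (hPost : Post (h.setArr r (a.val I h) (a'.val I h)) 6) :
    Sat I (.write r a a') h Post := by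
  intro s hs
  obtain ⟨s', e, hs', hreg⟩ := hs.exec_address r a
  refine ⟨_, 6, _, .seq e (.instr rfl), ?_, .setArr (List.mem_singleton_self r) _ _, hPost⟩
  rw [hreg, hs'.reg_operand]
  exact hs'.setArr r _ (a'.val_le hs')

theorem Sim.exec_load (hs : Sim I h s) {addr : ℕ} {P : Prop} [Decidable P] (haddr : s.reg 2 = addr)
    (hmem : s.mem addr = if P then 1 else 0) :
    ∃ s', Exec I.b (.instr (.load d.reg 2)) s s' 1 ∧ Sim I (h.set d (if P then 1 else 0)) s' :=
  hs.exec_set d (by unfold Input.bound; split_ifs <;> omega)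
    (by simp only [Instr.step, haddr, hmem])

open Classical in
theorem sat_fetchQ (ha : a.val I h < I.K) (ha' : a'.val I h < I.K)
    (hPost : Post (h.set d (if I.qle (a.val I h) (a'.val I h) then 1 else 0)) 3) :
    Sat I (.fetchQ d a a') h Post := by
  intro s hs
  have hlt : a.val I h * I.K + a'.val I h < I.K * I.K := by nlinarith
  have hbase : I.K * I.K + I.N * I.N < 2 ^ I.b := I.base_lt_word
  obtain ⟨s₁, e₁, hs₁, r₁, -⟩ := hs.exec_scratch (i := .mul 2 a.reg Operand.k.reg)
    (e := a.val I h * I.K) (.inl rfl) (by simp only [Instr.step, hs.reg_operand]; rfl) (by omega)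
  obtain ⟨s₂, e₂, hs₂, r₂, -⟩ := hs₁.exec_scratch (i := .add 2 2 a'.reg)
    (e := a.val I h * I.K + a'.val I h) (.inl rfl)
    (by simp only [Instr.step, r₁, hs₁.reg_operand]) (by omega)
  obtain ⟨s₃, e₃, hs₃⟩ := hs₂.exec_load (d := d) r₂ (hs₂.mem_qle _ ha _ ha')
  exact ⟨s₃, 3, _, .seq e₁ (.seq e₂ e₃), hs₃, .set (List.mem_singleton_self d) _, hPost⟩

open Classical in
theorem sat_fetchP (ha : a.val I h < I.N) (ha' : a'.val I h < I.N)
    (hPost : Post (h.set d (if I.le (a.val I h) (a'.val I h) then 1 else 0)) 4) :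
    Sat I (.fetchP d a a') h Post := by
  intro s hs
  have hlt : a.val I h * I.N + a'.val I h < I.N * I.N := by nlinarith
  have hbase : I.K * I.K + I.N * I.N < 2 ^ I.b := I.base_lt_word
  obtain ⟨s₁, e₁, hs₁, r₁, -⟩ := hs.exec_scratch (i := .mul 2 a.reg Operand.n.reg)
    (e := a.val I h * I.N) (.inl rfl) (by simp only [Instr.step, hs.reg_operand]; rfl) (by omega)
  obtain ⟨s₂, e₂, hs₂, r₂, -⟩ := hs₁.exec_scratch (i := .add 2 2 4)
    (e := I.K * I.K + a.val I h * I.N) (.inl rfl)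
    (by simp only [Instr.step, r₁, hs₁.reg_four, Nat.add_comm]) (by omega)
  obtain ⟨s₃, e₃, hs₃, r₃, -⟩ := hs₂.exec_scratch (i := .add 2 2 a'.reg)
    (e := I.K * I.K + a.val I h * I.N + a'.val I h) (.inl rfl)
    (by simp only [Instr.step, r₂, hs₂.reg_operand]) (by omega)
  obtain ⟨s₄, e₄, hs₄⟩ := hs₃.exec_load (d := d) r₃ (hs₃.mem_le _ ha _ ha')
  exact ⟨s₄, 4, _, .seq e₁ (.seq e₂ (.seq e₃ e₄)), hs₄, .set (List.mem_singleton_self d) _, hPost⟩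

theorem sat_seq (hp : Sat I p h fun h' t => Sat I q h' fun h'' t' => Post h'' (t + t')) :
    Sat I (p ⨾ q) h Post := by
  intro s hs
  obtain ⟨s', t, h', e, hs', hF, hq⟩ := hp s hs
  obtain ⟨s'', t', h'', e', hs'', hF', hPost⟩ := hq s' hs'
  exact ⟨s'', t + t', h'', .seq e e', hs'', hF.union_left.trans hF'.union_right, hPost⟩

theorem sat_ite (hp : c.Holds I h → Sat I p h fun h' t => Post h' (t + 1))
    (hq : ¬ c.Holds I h → Sat I q h fun h' t => Post h' (t + 1)) : Sat I (.ite c p q) h Post := by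
  intro s hs
  by_cases hc : c.Holds I h
  · obtain ⟨s', t, h', e, hs', hF, hPost⟩ := hp hc s hs
    exact ⟨s', t + 1, h', .ite_true ((Cond.holds_toTest hs).2 hc) e, hs',
      hF.union_left, hPost⟩
  · obtain ⟨s', t, h', e, hs', hF, hPost⟩ := hq hc s hs
    exact ⟨s', t + 1, h', .ite_false (mt (Cond.holds_toTest hs).1 hc) e, hs',
      hF.union_right, hPost⟩

/-- `J r` is the invariant when at most `r` rounds remain, and each round takes at most `e`
steps. -/
theorem sat_loop (J : ℕ → Store → Prop) (e r : ℕ) (h₀ : J r h)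
    (hbody : ∀ r h', Frame p.vars p.arrs h h' → J r h' → c.Holds I h' →
      Sat I p h' fun h'' t => t ≤ e ∧ ∃ r' < r, J r' h'') :
    Sat I (.loop c p) h fun h' t =>
      t ≤ r * (e + 1) + 1 ∧ ¬ c.Holds I h' ∧ ∃ r', J r' h' := by
  induction r using Nat.strong_induction_on generalizing h with
  | _ r ih =>
    intro s hs
    by_cases hc : c.Holds I h
    · obtain ⟨s', t, h', e₁, hs', hF, ht, r', hr, hJ⟩ := hbody r h (.refl h) h₀ hc s hs
      obtain ⟨s'', t', h'', e₂, hs'', hF', ht', hPost⟩ :=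
        ih r' hr hJ (fun r h'' hF' => hbody r h'' (hF.trans hF')) s' hs'
      have hmul : (r' + 1) * (e + 1) ≤ r * (e + 1) := Nat.mul_le_mul_right _ hr
      refine ⟨s'', _, h'', .loop_step ((Cond.holds_toTest hs).2 hc) e₁ e₂, hs'', hF.trans hF', ?_,
        hPost⟩
      linarith
    · exact ⟨s, 1, h, .loop_done (mt (Cond.holds_toTest hs).1 hc), hs, .refl h, by omega, hc, r,
        h₀⟩

/-- `for d < lim do p` -/
def Cmd.forLoop (d : Var) (lim : Operand) (p : Cmd) : Cmd :=
  .assign d 0 ⨾ .loop (.lt d lim) (p ⨾ .add d d .one)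

theorem sat_forLoop {lim : Operand} (J : ℕ → Store → Prop) (e : ℕ) (hd : d ∉ p.vars)
    (hlim : lim ∉ (Cmd.forLoop d lim p).vars.map Operand.var) (h₀ : J 0 (h.set d 0))
    (hbody : ∀ j < lim.val I h, ∀ h',
      Frame (Cmd.forLoop d lim p).vars (Cmd.forLoop d lim p).arrs h h' → h'.var d = j → J j h' →
        Sat I p h' fun h'' t => t ≤ e ∧ J (j + 1) (h''.set d (j + 1))) :
    Sat I (.forLoop d lim p) h fun h' t =>
      t ≤ lim.val I h * (e + 2) + 2 ∧ h'.var d = lim.val I h ∧ J (lim.val I h) h' := by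
  have hF₀ : Frame (Cmd.forLoop d lim p).vars (Cmd.forLoop d lim p).arrs h (h.set d 0) :=
    (Frame.set (List.mem_singleton_self d) 0).union_left (A := [])
  refine Sat.of_bounds fun hbound => sat_seq (sat_assign zero_le_one ?_)
  refine (sat_loop (fun r h' => h'.var d + r = lim.val I h ∧ J (h'.var d) h') (e + 1)
    (lim.val I h) (by simpa using h₀) fun r h' hF ⟨_, hJ⟩ hc => sat_seq ?_).imp ?_
  · have hF : Frame (Cmd.forLoop d lim p).vars (Cmd.forLoop d lim p).arrs h h' :=
      hF₀.trans hF.union_right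
    have hc : h'.var d < lim.val I h := by rw [← hF.val hlim]; exact hc
    refine (hbody _ hc h' hF rfl hJ).imp fun h'' t hF' ⟨_, hJ'⟩ => ?_
    have hd'' : h''.var d = h'.var d := hF'.var d hd
    refine sat_add ?_ ⟨by omega, r - 1, by omega, ?_, ?_⟩
    · have := hbound lim
      simp only [Operand.val_var, Operand.val_one]
      omega
    · simp only [Operand.val_var, Operand.val_one, Store.var_set, if_true]
      omega
    · simpa only [Operand.val_var, Operand.val_one, Store.var_set, if_true, hd''] using hJ'
  · rintro h' t hF ⟨ht, hc, r, hr, hJ⟩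
    have hF : Frame (Cmd.forLoop d lim p).vars (Cmd.forLoop d lim p).arrs h h' :=
      hF₀.trans hF.union_right
    have hc : ¬ h'.var d < lim.val I h := by rw [← hF.val hlim]; exact hc
    have hd : h'.var d = lim.val I h := by omega
    exact ⟨by rw [Nat.add_comm]; exact Nat.add_le_add_right ht 1, hd, hd ▸ hJ⟩

end Rules

open Cmd

/-! ### Climbing the chains -/

open Var Arr Operand in
/-- List the minimal elements of the chains in `bot`, count them in `m`, and point to them. -/
def collect : Cmd :=
  assign m 0 ⨾ forLoop i lim (fetch t prd i ⨾ ite (.eq t n)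
    (write bot m i ⨾ write ptr m i ⨾ add m m one) skip)

theorem collect_spec (hlim : h.var .lim ≤ I.N) :
    Sat I collect h fun h' t => t ≤ h.var .lim * 24 + 3 ∧
      Set.BijOn (h'.arr .bot) (Set.Iio (h'.var .m)) (bottoms I.N (h.arr .prd) (h.var .lim)) ∧
      ∀ q < h'.var .m, h'.arr .ptr q = h'.arr .bot q := by
  refine sat_seq <| sat_assign zero_le_one <| (sat_forLoop (fun j h' =>
    Set.BijOn (h'.arr .bot) (Set.Iio (h'.var .m)) (bottoms I.N (h.arr .prd) j) ∧
      ∀ q < h'.var .m, h'.arr .ptr q = h'.arr .bot q) 22 (by decide) (by decide) ?_ ?_).imp ?_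
  · simp [bottoms]
  · rintro j hj h' hF rfl ⟨hbot, hptr⟩
    have hprd : h'.arr .prd = h.arr .prd := hF.arr .prd
    refine sat_seq <| sat_fetch <| sat_ite (fun hc => ?_) fun hc => ?_
    · have hm : h'.var .m + 1 ≤ I.bound :=
        Nat.succ_le_of_lt <| (le_of_bijOn_bottoms hbot).trans_lt <|
          hj.trans_le <| hlim.trans <| by unfold Input.bound; omega
      refine sat_seq <| sat_write <| sat_seq <| sat_write <| sat_add hm
        ⟨by decide, bijOn_bottoms_update hbot (hprd ▸ hc), ?_⟩
      change ∀ q < h'.var .m + 1, Function.update (h'.arr .ptr) (h'.var .m) (h'.var .i) q =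
        Function.update (h'.arr .bot) (h'.var .m) (h'.var .i) q
      grind
    · have hne : h.arr .prd (h'.var .i) ≠ I.N := hprd ▸ hc
      exact sat_skip ⟨by decide, (bottoms_succ_of_ne hne).symm ▸ hbot, hptr⟩
  · rintro h' t - ⟨ht, -, hJ⟩
    exact ⟨by rw [Nat.add_comm]; exact Nat.add_le_add_right ht 1, hJ⟩

open Var Arr Operand in
/-- Let the first `l` pointers point to the minimal elements of the chains named by the digits. -/
def reset : Cmd :=
  forLoop i l (fetch t dig i ⨾ fetch t bot t ⨾ write ptr i t)

theorem reset_spec :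
    Sat I reset h fun h' t => t ≤ h.var .l * 20 + 2 ∧
      ∀ q < h.var .l, h'.arr .ptr q = h.arr .bot (h.arr .dig q) := by
  refine (sat_forLoop (fun j h' => ∀ q < j, h'.arr .ptr q = h.arr .bot (h.arr .dig q)) 18
    (by decide) (by decide) (by simp) ?_).imp fun h' t _ ⟨ht, _, hptr⟩ => ⟨ht, hptr⟩
  rintro j - h' hF rfl hptr
  have hbot : h'.arr .bot = h.arr .bot := hF.arr .bot
  have hdig : h'.arr .dig = h.arr .dig := hF.arr .dig
  refine sat_seq <| sat_fetch <| sat_seq <| sat_fetch <| sat_write ⟨by decide, ?_⟩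
  change ∀ q < h'.var .i + 1, Function.update (h'.arr .ptr) (h'.var .i)
    (h'.arr .bot (h'.arr .dig (h'.var .i))) q = _
  grind

open Classical in
/-- The program `rel` computes the truth value of `R i j` for `i, j < l`. -/
def Decides (I : Input) (rel : Prog) (R : ℕ → ℕ → Prop) (l : ℕ) : Prop :=
  ∀ h : Store, h.var .i < l → h.var .j < l → Sat I ⟨rel, [.rel], []⟩ h fun h' t =>
    t ≤ 3 ∧ h'.var .rel = if R (h.var .i) (h.var .j) then 1 else 0

open Var Arr in
/-- Compare the order of the pointers `i` and `j` with the relation that `p` computes. -/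
def comparePair (p : Prog) : Cmd :=
  ⟨p, [rel], []⟩ ⨾ fetch t ptr i ⨾ fetch u ptr j ⨾ fetchP carry t u ⨾
    ite (.lt rel carry) (assign found 1 ⨾ move v i ⨾ move w j)
      (ite (.lt carry rel) (assign found 1 ⨾ move v j ⨾ move w i) skip)

open Var in
/-- Compare the order of the pointer `i` and all other pointers with the relation that `p`
computes. -/
def scanRow (p : Prog) : Cmd :=
  forLoop j l (comparePair p)

open Var in
/-- Look for two pointers whose order differs from the relation that `p` computes. -/
def scan (p : Prog) : Cmd :=
  assign found 0 ⨾ forLoop i l (scanRow p)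

/-- The outcome of a search for a forced move among the pairs in `S`. -/
def ScanResult (I : Input) (R : ℕ → ℕ → Prop) (l : ℕ) (S : ℕ → ℕ → Prop) (h : Store) : Prop :=
  h.var .found = 0 ∧ (∀ a b, S a b → (R a b ↔ I.le (h.arr .ptr a) (h.arr .ptr b))) ∨
    h.var .found = 1 ∧ Forced I.le R l (h.arr .ptr) (h.var .v) (h.var .w)

theorem ScanResult.mono {R S S' : ℕ → ℕ → Prop} {l : ℕ} (hS : ScanResult I R l S h)
    (hSS' : ∀ a b, S' a b → S a b) : ScanResult I R l S' h :=
  hS.imp_left fun ⟨hf, h⟩ => ⟨hf, fun a b hab => h a b (hSS' a b hab)⟩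

open Classical in
theorem comparePair_spec {p : Prog} {R S : ℕ → ℕ → Prop} {l : ℕ} (hp : Decides I p R l)
    (hi : h.var .i < l) (hj : h.var .j < l) (hptr : ∀ q < l, h.arr .ptr q < I.N)
    (hS : ScanResult I R l S h) :
    Sat I (comparePair p) h fun h' t => t ≤ 24 ∧
      ScanResult I R l (fun a b => S a b ∨ a = h.var .i ∧ b = h.var .j) h' := by
  refine sat_seq <| (hp h hi hj).imp fun h' t hF ⟨ht, hrel⟩ => ?_
  rw [← hF.var .i] at hi hrel ⊢
  rw [← hF.var .j] at hj hrel ⊢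
  rw [← hF.arr .ptr] at hptr
  rw [ScanResult, ← hF.arr .ptr, ← hF.var .found, ← hF.var .v, ← hF.var .w] at hS
  refine sat_seq <| sat_fetch <| sat_seq <| sat_fetch <| sat_seq <|
    sat_fetchP (hptr _ hi) (hptr _ hj) ?_
  have rel_lt : (h'.var .rel < if I.le (h'.arr .ptr (h'.var .i)) (h'.arr .ptr (h'.var .j)) then 1
      else 0) ↔ ¬ R (h'.var .i) (h'.var .j) ∧
        I.le (h'.arr .ptr (h'.var .i)) (h'.arr .ptr (h'.var .j)) := by grind
  have lt_rel : ((if I.le (h'.arr .ptr (h'.var .i)) (h'.arr .ptr (h'.var .j)) then 1 else 0) <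
      h'.var .rel) ↔ R (h'.var .i) (h'.var .j) ∧
        ¬ I.le (h'.arr .ptr (h'.var .i)) (h'.arr .ptr (h'.var .j)) := by grind
  refine sat_ite (fun hc => ?_) fun hc => sat_ite (fun hc' => ?_) fun hc' => ?_
  · exact sat_seq <| sat_assign le_rfl <| sat_seq <| sat_move <| sat_move
      ⟨by omega, .inr ⟨rfl, hi, hj, .inl (rel_lt.1 hc)⟩⟩
  · exact sat_seq <| sat_assign le_rfl <| sat_seq <| sat_move <| sat_move
      ⟨by omega, .inr ⟨rfl, hj, hi, .inr (lt_rel.1 hc')⟩⟩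
  · have not_lt := mt rel_lt.2 hc
    have not_lt' := mt lt_rel.2 hc'
    refine sat_skip ⟨by omega, hS.imp_left fun ⟨hf, _⟩ => ⟨hf, ?_⟩⟩
    change ∀ a b, _ → (R a b ↔ I.le (h'.arr .ptr a) (h'.arr .ptr b))
    grind

theorem scanRow_spec {p : Prog} {R : ℕ → ℕ → Prop} {l : ℕ} (hp : Decides I p R l)
    (hl : h.var .l = l) (hi : h.var .i < l) (hptr : ∀ q < l, h.arr .ptr q < I.N)
    (hS : ScanResult I R l (fun a b => a < h.var .i ∧ b < l) h) :
    Sat I (scanRow p) h fun h' t => t ≤ l * 26 + 2 ∧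
      ScanResult I R l (fun a b => a < h.var .i + 1 ∧ b < l) h' := by
  subst hl
  refine (sat_forLoop (fun j h' => ScanResult I R (h.var .l)
    (fun a b => a < h.var .i ∧ b < h.var .l ∨ a = h.var .i ∧ b < j) h') 24
    (of_decide_eq_true rfl) (of_decide_eq_true rfl)
    ?_ ?_).imp
    fun h' t _ ⟨ht, _, hS⟩ => ⟨ht, hS.mono fun a b _ => by simp only [Operand.val_var]; omega⟩
  · exact ScanResult.mono (h := h) hS (by omega)
  · rintro j hj h' hF rfl hS
    have hi' : h'.var .i = h.var .i := hF.var .i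
    have hptr' : h'.arr .ptr = h.arr .ptr := hF.arr .ptr
    refine (comparePair_spec hp (hi' ▸ hi) hj (hptr' ▸ hptr) hS).imp
      fun h'' t _ ⟨ht, hS⟩ => ⟨ht, ?_⟩
    exact ScanResult.mono (h := h'') hS (by omega)

theorem scan_spec {p : Prog} {R : ℕ → ℕ → Prop} {l : ℕ} (hp : Decides I p R l)
    (hl : h.var .l = l) (hptr : ∀ q < l, h.arr .ptr q < I.N) :
    Sat I (scan p) h fun h' t => t ≤ l * (l * 26 + 4) + 3 ∧
      (h'.var .found = 0 ∧ Realizes I.le R l (h'.arr .ptr) ∨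
        h'.var .found = 1 ∧ Forced I.le R l (h'.arr .ptr) (h'.var .v) (h'.var .w)) := by
  subst hl
  refine sat_seq <| sat_assign zero_le_one <| (sat_forLoop (fun i h' =>
    ScanResult I R (h.var .l) (fun a b => a < i ∧ b < h.var .l) h') (h.var .l * 26 + 2)
    (of_decide_eq_true rfl) (of_decide_eq_true rfl) (.inl ⟨rfl, by omega⟩) ?_).imp
    fun h' t _ ⟨ht, _, hS⟩ => ⟨by rw [Nat.add_comm]; exact Nat.add_le_add_right ht 1,
      hS.imp_left fun ⟨hf, h⟩ => ⟨hf, fun a ha b hb => h a b ⟨ha, hb⟩⟩⟩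
  rintro i hi h' hF rfl hS
  have hl' : h'.var .l = h.var .l := hF.var .l
  have hptr' : h'.arr .ptr = h.arr .ptr := hF.arr .ptr
  exact scanRow_spec hp hl' hi (hptr' ▸ hptr) hS

open Var in
/-- Test whether `i = j`. -/
def equality : Cmd :=
  ite (.eq i j) (assign rel 1) (assign rel 0)

theorem decides_equality {l : ℕ} : Decides I equality.prog Eq l := by
  intro h _ _
  refine sat_ite (p := assign .rel 1) (q := assign .rel 0) (fun hc => ?_) fun hc => ?_
  · exact sat_assign le_rfl ⟨by decide, (if_pos hc).symm⟩
  · exact sat_assign zero_le_one ⟨by decide, (if_neg hc).symm⟩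

theorem decides_fetchQ : Decides I (fetchQ .rel Var.i Var.j).prog I.qle I.K :=
  fun _ hi hj => sat_fetchQ hi hj ⟨le_rfl, rfl⟩

open Var Arr Operand in
/-- Move the pointer `v` up its chain because of the pointer `w`, or stop if it is at the top. -/
def advancePointer : Cmd :=
  fetch u ptr v ⨾ fetch y ptr w ⨾ write wit u y ⨾ fetch t nxt u ⨾
    ite (.eq t n) (assign active 0) (write ptr v t)

open Var Operand in
/-- Make forced moves, recording their reasons in `wit`, until the pointers realize the relation
that `p` computes or a pointer would have to leave its chain. -/
def advance (p : Prog) : Cmd :=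
  assign active 1 ⨾ loop (.eq active one)
    (scan p ⨾ ite (.eq found one) advancePointer (assign active 0))

/-- The outcome of `advance`: either the pointers realize `R`, or the pointer `v`, which has to move
because of the pointer `w`, is at the top `u` of its chain. The invariant `J` still holds, in the
second case for the array `wit` as it was before it recorded the last reason. -/
def AdvanceResult (I : Input) (R : ℕ → ℕ → Prop) (l : ℕ) (J : ℕ → (ℕ → ℕ) → (ℕ → ℕ) → Prop)
    (h : Store) : Prop :=
  h.var .found = 0 ∧ Realizes I.le R l (h.arr .ptr) ∧ (∃ r, J r (h.arr .ptr) (h.arr .wit)) ∨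
    h.var .found = 1 ∧ Forced I.le R l (h.arr .ptr) (h.var .v) (h.var .w) ∧
      h.arr .ptr (h.var .v) = h.var .u ∧ h.arr .nxt (h.var .u) = I.N ∧
        ∃ r wit, J r (h.arr .ptr) wit ∧
          h.arr .wit = Function.update wit (h.var .u) (h.arr .ptr (h.var .w))

section Advance

variable {R : ℕ → ℕ → Prop} {l r : ℕ} {J : ℕ → (ℕ → ℕ) → (ℕ → ℕ) → Prop}

theorem advancePointer_spec (hA : AdvanceInvariant I.le R I.N l (h.arr .nxt) J)
    (hJ : J r (h.arr .ptr) (h.arr .wit)) (hfound : h.var .found = 1) (hactive : h.var .active = 1)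
    (hF : Forced I.le R l (h.arr .ptr) (h.var .v) (h.var .w)) :
    Sat I advancePointer h fun h' t => t ≤ 31 ∧
      (h'.var .active = 0 ∧ AdvanceResult I R l J h' ∨
        h'.var .active = 1 ∧ ∃ r' < r, J r' (h'.arr .ptr) (h'.arr .wit)) := by
  refine sat_seq <| sat_fetch <| sat_seq <| sat_fetch <| sat_seq <| sat_write <| sat_seq <|
    sat_fetch <| sat_ite (fun hc => ?_) fun hc => ?_
  · exact sat_assign zero_le_one
      ⟨by decide, .inl ⟨rfl, .inr ⟨hfound, hF, rfl, hc, r, _, hJ, rfl⟩⟩⟩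
  · exact sat_write ⟨by decide, .inr ⟨hactive, hA.move hJ hF hc⟩⟩

theorem advance_spec {p : Prog} (hp : Decides I p R l) (hl : h.var .l = l)
    (hA : AdvanceInvariant I.le R I.N l (h.arr .nxt) J) (hJ : J r (h.arr .ptr) (h.arr .wit)) :
    Sat I (advance p) h fun h' t => t ≤ (r + 1) * (l * (l * 26 + 4) + 36) + 2 ∧
      AdvanceResult I R l J h' := by
  refine sat_seq <| sat_assign le_rfl <| (sat_loop (fun r₁ h' =>
    h'.var .active = 0 ∧ AdvanceResult I R l J h' ∨
      h'.var .active = 1 ∧ ∃ r' < r₁, J r' (h'.arr .ptr) (h'.arr .wit))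
    (l * (l * 26 + 4) + 35) (r + 1) ?_ ?_).imp ?_
  · exact .inr ⟨rfl, r, r.lt_succ_self, hJ⟩
  · rintro r₁ h₁ hF₁ (⟨hactive, -⟩ | ⟨hactive, r', hr', hJ₁⟩) hc
    · exact absurd (hc.symm.trans hactive) one_ne_zero
    have hl₁ : h₁.var .l = l := (hF₁.var .l).trans hl
    have hnxt₁ : h₁.arr .nxt = h.arr .nxt := hF₁.arr .nxt
    refine sat_seq <| (scan_spec hp hl₁ (hA.ptr_lt hJ₁)).imp fun h₂ t hF₂ ⟨ht, hS⟩ => ?_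
    rw [← hF₂.arr .ptr, ← hF₂.arr .wit] at hJ₁
    rw [← hF₂.var .active] at hactive
    rw [← hnxt₁, ← hF₂.arr .nxt] at hA
    refine sat_ite (fun hc => ?_) fun hc => ?_
    · obtain ⟨hfound, hF⟩ := hS.resolve_left fun h => one_ne_zero (hc.symm.trans h.1)
      refine (advancePointer_spec hA hJ₁ hfound hactive hF).imp fun h₃ t' _ ⟨_, hJ₃⟩ =>
        ⟨by omega, r', hr', hJ₃⟩
    · obtain ⟨hfound, hR⟩ := hS.resolve_right fun h => hc h.1
      exact sat_assign zero_le_one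
        ⟨by omega, r', hr', .inl ⟨rfl, .inl ⟨hfound, hR, r', hJ₁⟩⟩⟩
  · rintro h' t - ⟨ht, hc, -, ⟨-, hres⟩ | ⟨hactive, -⟩⟩
    · exact ⟨by linarith, hres⟩
    · exact absurd hactive hc

end Advance

/-! ### Partition into chains -/

open Var Arr Operand in
/-- Perform the exchange that starts at `u`, which decreases the number of chains. -/
def augment : Cmd :=
  loop (.lt u n) (fetch y wit u ⨾ fetch t prd y ⨾ write prd y u ⨾ write nxt u y ⨾ move u t)

/-- `AugmentInvariant lt N wit c X r prd nxt u`: at most `r` elements have yet to be relinked,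
beginning with `u`, until the number of chains is smaller than `c`. -/
def AugmentInvariant (lt : ℕ → ℕ → Prop) (N : ℕ) (wit : ℕ → ℕ) (c X r : ℕ) (prd nxt : ℕ → ℕ)
    (u : ℕ) : Prop :=
  Links lt N prd nxt X u ∧
    (u = N ∧ (bottoms N prd X).card + 1 = c ∨
      ∃ L : List ℕ, L.length < r ∧ Exchange lt N prd wit X (u :: L) ∧ (bottoms N prd X).card = c)

theorem AugmentInvariant.relink {lt : ℕ → ℕ → Prop} {N c X r u : ℕ} {prd nxt wit : ℕ → ℕ}
    (hX : X ≤ N) (hu : u < N) (hJ : AugmentInvariant lt N wit c X r prd nxt u) :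
    ∃ r' < r, AugmentInvariant lt N wit c X r' (Function.update prd (wit u) u)
      (Function.update nxt u (wit u)) (prd (wit u)) := by
  obtain ⟨hlinks, ⟨rfl, -⟩ | ⟨L, hr, hL, hcard⟩⟩ := hJ
  · omega
  have head := hL.head
  have hlinks' := hlinks.relink hX head.lt_bound head.wit_lt_bound head.lt_wit
  have hcard' := card_bottoms_relink (prd := prd) head.wit_lt_bound hu.ne
  rcases head.prd_wit with hN | hmem
  · exact ⟨0, by omega, hlinks', .inl ⟨hN, by rw [if_pos hN] at hcard'; omega⟩⟩
  · obtain ⟨L', hL', hlen⟩ := hL.tail.exists_suffix hmem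
    have hN : prd (wit u) ≠ N := by have := hL'.head.lt_bound; omega
    exact ⟨L'.length + 1, by omega, hlinks', .inr ⟨L', by omega, hL'.update_prd hL'.head.notMem hN,
      by rw [if_neg hN] at hcard'; omega⟩⟩

theorem augment_spec {lt : ℕ → ℕ → Prop} {X : ℕ} {L : List ℕ} (hX : X ≤ I.N)
    (hL : Exchange lt I.N (h.arr .prd) (h.arr .wit) X (h.var .u :: L))
    (hlinks : Links lt I.N (h.arr .prd) (h.arr .nxt) X (h.var .u)) :
    Sat I augment h fun h' t => t ≤ X * 26 + 1 ∧
      Links lt I.N (h'.arr .prd) (h'.arr .nxt) X I.N ∧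
        (bottoms I.N (h'.arr .prd) X).card + 1 = (bottoms I.N (h.arr .prd) X).card := by
  have hlen : (L.length + 1) * 26 ≤ X * 26 := Nat.mul_le_mul_right _ hL.length_le
  refine (sat_loop (fun r h' => AugmentInvariant lt I.N (h.arr .wit)
    (bottoms I.N (h.arr .prd) X).card X r (h'.arr .prd) (h'.arr .nxt) (h'.var .u)) 25
    (L.length + 1) ?_ ?_).imp ?_
  · exact ⟨hlinks, .inr ⟨L, L.length.lt_succ_self, hL, rfl⟩⟩
  · rintro r h' hF hJ hc
    have hJ' := hJ.relink hX hc
    rw [← hF.arr .wit] at hJ'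
    refine sat_seq <| sat_fetch <| sat_seq <| sat_fetch <| sat_seq <| sat_write <| sat_seq <|
      sat_write <| sat_move ⟨by decide, ?_⟩
    rw [← hF.arr .wit]
    exact hJ'
  · rintro h' t - ⟨ht, hc, r, hlinks', ⟨hu, hcard⟩ | ⟨L', -, hL', -⟩⟩
    · exact ⟨by omega, hu ▸ hlinks', hcard⟩
    · exact absurd (hL'.head.lt_bound.trans_le hX) hc

open Var Arr Operand in
/-- Add the element `x` to the chains as a chain of its own. -/
def addChain : Cmd :=
  add lim x one ⨾ write prd x n ⨾ write nxt x n

open Var Operand in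
/-- Perform an exchange on the chains below `lim` if there is no antichain that meets them all. -/
def reduceChains : Cmd :=
  collect ⨾ move l m ⨾ advance equality.prog ⨾ ite (.eq found one) augment skip

/-- Partition `P` into chains. -/
def decompose : Cmd :=
  forLoop .x .n (addChain ⨾ reduceChains)

/-- The links in `h` describe a partition of the elements below `X` into at most `W` chains. -/
def Decomposed (I : Input) (W X : ℕ) (h : Store) : Prop :=
  Links (StrictPart I.le) I.N (h.arr .prd) (h.arr .nxt) X I.N ∧
    (bottoms I.N (h.arr .prd) X).card ≤ W

theorem addChain_spec {W : ℕ} (hx : h.var .x < I.N) (hD : Decomposed I W (h.var .x) h) :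
    Sat I addChain h fun h' t => t = 13 ∧ h'.var .lim = h.var .x + 1 ∧
      Decomposed I (W + 1) (h.var .x + 1) h' := by
  refine sat_seq <| sat_add (hx.trans (by unfold Input.bound; omega)) <| sat_seq <| sat_write <|
    sat_write ⟨rfl, rfl, hD.1.insert, ?_⟩
  exact card_bottoms_insert.trans_le (Nat.succ_le_succ hD.2)

theorem reduceChains_cost {N W X m t t' t'' : ℕ} (hX : 1 ≤ X) (hXN : X ≤ N) (hm : m ≤ W + 1)
    (ht : t ≤ X * 24 + 3) (ht' : t' ≤ (X + 1) * (m * (m * 26 + 4) + 36) + 2)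
    (ht'' : t'' ≤ X * 26 + 1) : t + (1 + (t' + (t'' + 1))) ≤ 96 * N * (W + 2) ^ 2 := by
  have hscan : m * (m * 26 + 4) + 36 ≤ 35 * (W + 2) ^ 2 := by nlinarith
  have hadvance := Nat.mul_le_mul (show X + 1 ≤ 2 * N by omega) hscan
  have hN : N * 4 ≤ N * (W + 2) ^ 2 := Nat.mul_le_mul_left N (by nlinarith)
  linarith

section Decompose

variable [Std.Refl I.le] {W : ℕ}

theorem reduceChains_spec (hW : WidthLE I.le I.N W) (hlim : 1 ≤ h.var .lim) (hN : h.var .lim ≤ I.N)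
    (hD : Decomposed I (W + 1) (h.var .lim) h) :
    Sat I reduceChains h fun h' t => t ≤ 96 * I.N * (W + 2) ^ 2 ∧
      Decomposed I W (h.var .lim) h' := by
  obtain ⟨hlinks, hcard⟩ := hD
  refine sat_seq <| (collect_spec hN).imp fun h₁ t₁ hF₁ ⟨ht₁, hbot, hptr⟩ => sat_seq <| sat_move <|
    sat_seq ?_
  have hm := card_eq_of_bijOn_bottoms hbot
  have hnxt₁ : h₁.arr .nxt = h.arr .nxt := hF₁.arr .nxt
  rw [← hnxt₁] at hlinks
  refine (advance_spec (h := h₁.set .l (h₁.var .m)) decides_equality rfl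
    (Search.advanceInvariant hN hlinks) ⟨[], rfl, .of_bijOn hbot hptr⟩).imp
    fun h₂ t₂ hF₂ ⟨ht₂, hres⟩ => ?_
  have hprd₂ : h₂.arr .prd = h.arr .prd := (hF₂.arr .prd).trans (hF₁.arr .prd)
  have hnxt₂ : h₂.arr .nxt = h₁.arr .nxt := hF₂.arr .nxt
  have hcost (t : ℕ) := reduceChains_cost (t'' := t) hlim hN (hm.trans_le hcard) ht₁ ht₂
  rw [← hnxt₂, ← hprd₂] at hlinks
  rw [← hprd₂] at hcard
  refine sat_ite (fun hc => ?_) fun hc => ?_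
  · obtain ⟨-, hF, hu, hnxt, r, wit, ⟨L, -, hS⟩, hwit⟩ :=
      hres.resolve_left fun h => one_ne_zero (hc.symm.trans h.1)
    have hL := hS.exchange_cons hF.1 hF.2.1 (hF.strictPart hS.injOn)
    rw [hu, ← hwit, ← hprd₂] at hL
    refine (augment_spec hN hL (hlinks.dangling hN hnxt)).imp fun h₃ t₃ _ ⟨ht₃, hlinks', _⟩ =>
      ⟨hcost t₃ ht₃, hlinks', by omega⟩
  · obtain ⟨-, hR, r, L, -, hS⟩ := hres.resolve_right fun h => hc h.1
    refine sat_skip ⟨hcost 1 (by omega), hlinks, ?_⟩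
    rw [hprd₂, ← hm]
    exact hR.le_of_widthLE hW fun q hq => (hS.lt_bound q hq).trans_le hN

theorem decompose_spec (hW : WidthLE I.le I.N W) :
    Sat I decompose h fun h' t => t ≤ I.N * (100 * I.N * (W + 2) ^ 2 + 2) + 2 ∧
      Decomposed I W I.N h' := by
  refine (sat_forLoop (fun j h' => Decomposed I W j h') (100 * I.N * (W + 2) ^ 2)
    (by decide) (by decide) ?_ ?_).imp fun h' t _ ⟨ht, _, hD⟩ => ⟨ht, hD⟩
  · exact ⟨⟨by simp, by simp⟩, (Finset.card_filter_le _ _).trans (Nat.zero_le W)⟩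
  · rintro x hx h' - rfl hD
    refine sat_seq <| (addChain_spec hx hD).imp fun h₁ t₁ _ ⟨_, hlim, hD₁⟩ => ?_
    rw [← hlim] at hD₁
    refine (reduceChains_spec hW (by omega) (hlim.trans_le hx) hD₁).imp
      fun h₂ t₂ _ ⟨_, hD₂⟩ => ⟨?_, hlim ▸ hD₂⟩
    have : 1 * 4 ≤ I.N * (W + 2) ^ 2 := Nat.mul_le_mul (Nat.one_le_of_lt hx)
      (Nat.pow_le_pow_left (Nat.le_add_left 2 W) 2)
    linarith

end Decompose

/-! ### Enumeration of the assignments -/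

open Var Arr Operand in
/-- Increase the number with the digits `dig` in base `m` by one. -/
def increment : Cmd :=
  assign carry 1 ⨾ forLoop i k (fetch t dig i ⨾ add t t carry ⨾
    ite (.lt t m) (assign carry 0) (assign t 0 ⨾ assign carry 1) ⨾ write dig i t)

/-- The state of `increment` at the digit `j`. -/
def IncrementInvariant (m K M : ℕ) (j carry : ℕ) (dig : ℕ → ℕ) : Prop :=
  Digits m j (M + 1) dig ∧ (∀ q < K, j ≤ q → dig q = M / m ^ q % m) ∧ carry ≤ 1 ∧
    (M + 1) / m ^ j = M / m ^ j + carry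

theorem IncrementInvariant.succ {m K M j c : ℕ} {dig : ℕ → ℕ} (hm : 0 < m) (hj : j < K)
    (hJ : IncrementInvariant m K M j c dig) :
    IncrementInvariant m K M (j + 1) (if dig j + c < m then 0 else 1)
      (Function.update dig j (if dig j + c < m then dig j + c else 0)) := by
  obtain ⟨hlow, hhigh, hc, hdiv⟩ := hJ
  obtain ⟨hdigit, hcarry⟩ := carry_step hm hc hdiv
  rw [← hhigh j hj le_rfl] at hdigit hcarry
  refine ⟨fun q hq => ?_, fun q hq hjq => ?_, by split_ifs <;> omega, hcarry⟩
  · rcases eq_or_ne q j with rfl | hne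
    · rw [Function.update_self, hdigit]
    · rw [Function.update_of_ne hne, hlow q (by omega)]
  · rw [Function.update_of_ne (by omega), hhigh q hq (by omega)]

theorem increment_spec {M : ℕ} (hm : 0 < h.var .m) (hmN : h.var .m ≤ I.N)
    (hM : M < h.var .m ^ I.K) (hdig : Digits (h.var .m) I.K M (h.arr .dig)) :
    Sat I increment h fun h' t => t ≤ I.K * 18 + 3 ∧
      Digits (h.var .m) I.K (M + 1) (h'.arr .dig) ∧
        (h'.var .carry = 1 ↔ M + 1 = h.var .m ^ I.K) := by
  refine sat_seq <| sat_assign le_rfl <| (sat_forLoop (fun j h' =>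
    IncrementInvariant (h.var .m) I.K M j (h'.var .carry) (h'.arr .dig)) 16 (by decide)
    (by decide) ?_ ?_).imp ?_
  · exact ⟨by simp [Digits], fun q hq _ => hdig q hq, le_rfl, by simp⟩
  · rintro j hj h' hF rfl hJ
    have hm' : h'.var .m = h.var .m := hF.var .m
    have hlt : h'.arr .dig (h'.var .i) < h.var .m :=
      hJ.2.1 _ hj le_rfl ▸ Nat.mod_lt _ hm
    have hJ' := hJ.succ hm hj
    have hbound : h'.arr .dig (h'.var .i) + h'.var .carry ≤ I.bound :=
      Nat.add_le_add (hlt.le.trans (hmN.trans (Nat.le_add_left _ _))) hJ.2.2.1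
    rw [← hm'] at hJ'
    refine sat_seq <| sat_fetch <| sat_seq <| sat_add hbound <| sat_seq <| sat_ite (fun hc => ?_)
      fun hc => ?_
    · replace hc : h'.arr .dig (h'.var .i) + h'.var .carry < h'.var .m := hc
      rw [if_pos hc, if_pos hc, hm'] at hJ'
      exact sat_assign zero_le_one <| sat_write ⟨by decide, hJ'⟩
    · replace hc : ¬ h'.arr .dig (h'.var .i) + h'.var .carry < h'.var .m := hc
      rw [if_neg hc, if_neg hc, hm'] at hJ'
      exact sat_seq <| sat_assign zero_le_one <| sat_assign le_rfl <| sat_write ⟨by decide, hJ'⟩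
  · rintro h' t - ⟨ht, -, hdig', -, -, hcarry⟩
    exact ⟨by rw [Nat.add_comm]; exact Nat.add_le_add_right ht 1, hdig',
      carry_eq_one_iff hm hM hcarry⟩

/-- `P` contains a copy of `Q`. -/
def Input.HasSolution (I : Input) : Prop :=
  ∃ s : ℕ → ℕ, (∀ q < I.K, s q < I.N) ∧ Realizes I.le I.qle I.K s

/-- No copy of `Q` in `P` has its elements above the elements `start q` of the respective chains. -/
def Input.Excludes (I : Input) (nxt start : ℕ → ℕ) : Prop :=
  ∀ s, Realizes I.le I.qle I.K s → ¬ ∀ q < I.K, Reach I.N nxt (start q) (s q)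

theorem Input.Excludes.congr {nxt start start' : ℕ → ℕ} (hE : I.Excludes nxt start)
    (hstart : ∀ q < I.K, start q = start' q) : I.Excludes nxt start' :=
  fun s hs hreach => hE s hs fun q hq => hstart q hq ▸ hreach q hq

open Var Operand in
/-- Look for a copy of `Q` whose elements lie on the chains named by the digits. -/
def tryDigits : Cmd :=
  reset ⨾ advance (fetchQ rel i j).prog

open Var Operand in
/-- Try the assignment of chains that is given by the digits, and proceed to the next one. -/
def enumerationStep : Cmd :=
  tryDigits ⨾ ite (.eq found one) (increment ⨾ ite (.eq carry one) (assign more 0) skip)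
    (assign res 1 ⨾ assign more 0)

open Var Operand in
/-- Try all assignments of chains to the elements of `Q`. -/
def enumerate : Cmd :=
  move lim n ⨾ collect ⨾ move l k ⨾ assign res 0 ⨾ assign more 1 ⨾
    loop (.eq more one) enumerationStep

theorem tryDigits_cost {K N r t t' : ℕ} (hK : 1 ≤ K) (hN : 1 ≤ N) (ht : t ≤ K * 20 + 2)
    (hr : r ≤ K * N) (ht' : t' ≤ (r + 1) * (K * (K * 26 + 4) + 36) + 2) :
    t + t' ≤ 160 * (K ^ 3 * N) := by
  have hscan : K * (K * 26 + 4) + 36 ≤ 66 * K ^ 2 := by nlinarith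
  have hKN : 1 ≤ K * N := Nat.mul_pos hK hN
  have hadvance := Nat.mul_le_mul (show r + 1 ≤ 2 * (K * N) by omega) hscan
  have hcube : 1 * K ≤ K * N * (K * K) :=
    Nat.mul_le_mul hKN (Nat.le_mul_of_pos_right K hK)
  nlinarith

section Enumerate

variable [IsPartialOrder ℕ I.le] {prd nxt : ℕ → ℕ}

theorem tryDigits_spec (hK : 1 ≤ I.K) (hN : 1 ≤ I.N) (hl : h.var .l = I.K)
    (hL : Links (StrictPart I.le) I.N (h.arr .prd) (h.arr .nxt) I.N I.N)
    (hbot : ∀ q < I.K, h.arr .bot (h.arr .dig q) < I.N) :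
    Sat I tryDigits h fun h' t => t ≤ 160 * (I.K ^ 3 * I.N) ∧
      (h'.var .found = 0 ∧ I.HasSolution ∨
        h'.var .found = 1 ∧ I.Excludes (h.arr .nxt) fun q => h.arr .bot (h.arr .dig q)) := by
  refine sat_seq <| reset_spec.imp fun h₁ t₁ hF₁ ⟨ht₁, hptr⟩ => ?_
  have hl₁ : h₁.var .l = I.K := (hF₁.var .l).trans hl
  have hnxt₁ : h₁.arr .nxt = h.arr .nxt := hF₁.arr .nxt
  rw [hl] at ht₁ hptr
  rw [← hnxt₁] at hL
  have hA := Reach.advanceInvariant (R := I.qle) (l := I.K) hL (h₁.arr .ptr)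
  refine (advance_spec decides_fetchQ hl₁ hA ⟨fun q hq => hptr q hq ▸ hbot q hq, le_rfl,
    fun s _ h => h⟩).imp fun h₂ t₂ hF₂ ⟨ht₂, hres⟩ =>
    ⟨tryDigits_cost hK hN ht₁ sum_height_le ht₂, ?_⟩
  rcases hres with ⟨hfound, hR, r, hlt, -⟩ | ⟨hfound, hF, hu, hnxt, r, wit, ⟨hlt, -, hreach⟩, -⟩
  · exact .inl ⟨hfound, _, hlt, hR⟩
  · refine .inr ⟨hfound, fun s hs hs₀ => ?_⟩
    rw [← hnxt₁] at hs₀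
    have hs₁ := hreach s hs fun q hq => hptr q hq ▸ hs₀ q hq
    have hmove := (hF.reach hL hlt hs hs₁).1
    have hnxt₂ : h₂.arr .nxt = h₁.arr .nxt := hF₂.arr .nxt
    rw [hu, ← hnxt₂, hnxt] at hmove
    exact hmove.false

theorem Input.HasSolution.exists_reach {m : ℕ} {bot : ℕ → ℕ} (hI : I.HasSolution)
    (hL : Links (StrictPart I.le) I.N prd nxt I.N I.N)
    (hbot : Set.BijOn bot (Set.Iio m) (bottoms I.N prd I.N)) :
    ∃ M < m ^ I.K, ¬ I.Excludes nxt fun q => bot (M / m ^ q % m) := by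
  obtain ⟨s, hsN, hs⟩ := hI
  have hex : ∀ q, ∃ d, q < I.K → d < m ∧ Reach I.N nxt (bot d) (s q) := fun q => by
    by_cases hq : q < I.K
    · obtain ⟨d, hd⟩ := exists_reach_of_bijOn hL hbot (hsN q hq)
      exact ⟨d, fun _ => hd⟩
    · exact ⟨0, fun h => absurd h hq⟩
  choose f hf using hex
  obtain ⟨M, hM, hD⟩ := exists_digits fun q hq => (hf q hq).1
  refine ⟨M, hM, fun hE => hE s hs fun q hq => ?_⟩
  change Reach I.N nxt (bot (M / m ^ q % m)) (s q)
  exact hD q hq ▸ (hf q hq).2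

/-- The state of `enumerate`: at most `r` assignments of chains have yet to be tried. -/
def EnumerationInvariant (I : Input) (nxt bot : ℕ → ℕ) (m r : ℕ) (h : Store) : Prop :=
  h.var .more = 1 ∧ h.var .res = 0 ∧ (∃ M, M + r = m ^ I.K ∧ 0 < r ∧ Digits m I.K M (h.arr .dig) ∧
    ∀ M' < M, I.Excludes nxt fun q => bot (M' / m ^ q % m)) ∨
  h.var .more = 0 ∧ (h.var .res = 1 ∧ I.HasSolution ∨
    h.var .res = 0 ∧ ∀ M < m ^ I.K, I.Excludes nxt fun q => bot (M / m ^ q % m))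

theorem enumerationStep_spec {r : ℕ} (hK : 1 ≤ I.K) (hN : 1 ≤ I.N) (hl : h.var .l = I.K)
    (hL : Links (StrictPart I.le) I.N (h.arr .prd) (h.arr .nxt) I.N I.N)
    (hbot : Set.BijOn (h.arr .bot) (Set.Iio (h.var .m)) (bottoms I.N (h.arr .prd) I.N))
    (hJ : EnumerationInvariant I (h.arr .nxt) (h.arr .bot) (h.var .m) r h)
    (hc : h.var .more = 1) :
    Sat I enumerationStep h fun h' t => t ≤ 184 * (I.K ^ 3 * I.N) ∧
      ∃ r' < r, EnumerationInvariant I (h.arr .nxt) (h.arr .bot) (h.var .m) r' h' := by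
  obtain ⟨-, hres, M, hM, hr, hdig, hE⟩ := hJ.resolve_right fun h => zero_ne_one (h.1.symm.trans hc)
  have hm := pos_of_bijOn_bottoms hL hbot hN
  have hmN := le_of_bijOn_bottoms hbot
  have hcost : I.K * 1 ≤ I.K ^ 3 * I.N :=
    Nat.mul_le_mul (Nat.le_self_pow three_ne_zero I.K) hN
  refine sat_seq <| (tryDigits_spec hK hN hl hL fun q hq => (mem_bottoms.1 <|
    hbot.mapsTo <| Set.mem_Iio.2 <| hdig q hq ▸ Nat.mod_lt _ hm).1).imp
      fun h₁ t₁ hF₁ ⟨ht₁, hfound⟩ => ?_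
  have hres₁ : h₁.var .res = 0 := (hF₁.var .res).trans hres
  have hmore₁ : h₁.var .more = 1 := (hF₁.var .more).trans hc
  have hm₁ : h₁.var .m = h.var .m := hF₁.var .m
  have hdig₁ : h₁.arr .dig = h.arr .dig := hF₁.arr .dig
  refine sat_ite (fun hc' => ?_) fun hc' => ?_
  · replace hE : ∀ M' < M + 1, I.Excludes (h.arr .nxt) fun q =>
        h.arr .bot (M' / h.var .m ^ q % h.var .m) :=
      Nat.forall_lt_succ_right.2 ⟨hE, (hfound.resolve_left fun h => zero_ne_one
        (h.1.symm.trans hc')).2.congr fun q hq => congrArg _ (hdig q hq)⟩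
    rw [← hm₁] at hm hmN hM hdig hE ⊢
    refine sat_seq <| (increment_spec (M := M) hm hmN (by omega) (hdig₁ ▸ hdig)).imp
      fun h₂ t₂ hF₂ ⟨_, hdig₂, hcarry⟩ => ?_
    have hres₂ : h₂.var .res = 0 := (hF₂.var .res).trans hres₁
    refine sat_ite (fun hc'' => ?_) fun hc'' => ?_
    · exact sat_assign zero_le_one ⟨by omega, 0, hr, .inr ⟨rfl, .inr ⟨hres₂,
        hcarry.1 hc'' ▸ hE⟩⟩⟩
    · have hne := mt hcarry.2 hc''
      exact sat_skip ⟨by omega, r - 1, by omega, .inl ⟨(hF₂.var .more).trans hmore₁, hres₂,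
        M + 1, by omega, by omega, hdig₂, hE⟩⟩
  · have hsol := (hfound.resolve_right fun h => hc' h.1).2
    exact sat_seq <| sat_assign le_rfl <| sat_assign zero_le_one
      ⟨by omega, 0, hr, .inr ⟨rfl, .inl ⟨rfl, hsol⟩⟩⟩

theorem enumerationLoop_spec (hK : 1 ≤ I.K) (hN : 1 ≤ I.N) (hl : h.var .l = I.K)
    (hL : Links (StrictPart I.le) I.N (h.arr .prd) (h.arr .nxt) I.N I.N)
    (hbot : Set.BijOn (h.arr .bot) (Set.Iio (h.var .m)) (bottoms I.N (h.arr .prd) I.N))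
    (hdig : ∀ q < I.K, h.arr .dig q = 0) (hres : h.var .res = 0) (hmore : h.var .more = 1) :
    Sat I (loop (.eq (.var .more) .one) enumerationStep) h fun h' t =>
      t ≤ h.var .m ^ I.K * (184 * (I.K ^ 3 * I.N) + 1) + 1 ∧
        (h'.var .res = 1 ∧ I.HasSolution ∨ h'.var .res = 0 ∧ ¬ I.HasSolution) := by
  refine (sat_loop (EnumerationInvariant I (h.arr .nxt) (h.arr .bot) (h.var .m))
    (184 * (I.K ^ 3 * I.N)) (h.var .m ^ I.K) ?_ ?_).imp ?_
  · exact .inl ⟨hmore, hres, 0, Nat.zero_add _, Nat.pow_pos (pos_of_bijOn_bottoms hL hbot hN),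
      fun q hq => (hdig q hq).trans (by simp), by simp⟩
  · intro r h' hF hJ hc
    have hl' : h'.var .l = I.K := (hF.var .l).trans hl
    have hm' : h'.var .m = h.var .m := hF.var .m
    have hbot' : h'.arr .bot = h.arr .bot := hF.arr .bot
    have hprd' : h'.arr .prd = h.arr .prd := hF.arr .prd
    have hnxt' : h'.arr .nxt = h.arr .nxt := hF.arr .nxt
    rw [← hnxt', ← hprd'] at hL
    rw [← hm', ← hbot', ← hprd'] at hbot
    rw [← hnxt', ← hm', ← hbot'] at hJ ⊢
    exact enumerationStep_spec hK hN hl' hL hbot hJ hc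
  · rintro h' t - ⟨ht, hc, r, hJ⟩
    have hanswer := (hJ.resolve_left fun h => hc h.1).2
    refine ⟨ht, hanswer.imp_right fun ⟨hres, hE⟩ => ⟨hres, fun hI => ?_⟩⟩
    obtain ⟨M, hM, hne⟩ := hI.exists_reach hL hbot
    exact hne (hE M hM)

theorem enumerate_spec {W : ℕ} (hK : 1 ≤ I.K) (hN : 1 ≤ I.N) (hD : Decomposed I W I.N h)
    (hdig : ∀ q < I.K, h.arr .dig q = 0) :
    Sat I enumerate h fun h' t => t ≤ W ^ I.K * (185 * (I.K ^ 3 * I.N)) + 24 * I.N + 8 ∧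
      (h'.var .res = 1 ∧ I.HasSolution ∨ h'.var .res = 0 ∧ ¬ I.HasSolution) := by
  obtain ⟨hL, hcard⟩ := hD
  refine sat_seq <| sat_move <| sat_seq <| (collect_spec le_rfl).imp
    fun h₁ t₁ hF₁ ⟨ht₁, hbot, _⟩ => sat_seq <| sat_move <| sat_seq <| sat_assign zero_le_one <|
      sat_seq <| sat_assign le_rfl ?_
  have hnxt₁ : h₁.arr .nxt = h.arr .nxt := hF₁.arr .nxt
  have hprd₁ : h₁.arr .prd = h.arr .prd := hF₁.arr .prd
  have hdig₁ : h₁.arr .dig = h.arr .dig := hF₁.arr .dig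
  have hmW : h₁.var .m ≤ W := (card_eq_of_bijOn_bottoms hbot).trans_le hcard
  rw [← hnxt₁, ← hprd₁] at hL
  replace hbot : Set.BijOn (h₁.arr .bot) (Set.Iio (h₁.var .m)) (bottoms I.N (h₁.arr .prd) I.N) :=
    hprd₁ ▸ hbot
  refine (enumerationLoop_spec (h := ((h₁.set .l I.K).set .res 0).set .more 1) hK hN rfl hL hbot
    (fun q hq => (congrFun hdig₁ q).trans (hdig q hq)) rfl rfl).imp
    fun h₂ t₂ _ ⟨ht₂, hres⟩ => ⟨?_, hres⟩
  replace ht₁ : t₁ ≤ I.N * 24 + 3 := ht₁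
  replace ht₂ : t₂ ≤ h₁.var .m ^ I.K * (184 * (I.K ^ 3 * I.N) + 1) + 1 := ht₂
  have hpos : 1 ≤ I.K ^ 3 * I.N := Nat.mul_pos (Nat.pow_pos hK) hN
  have hrounds : h₁.var .m ^ I.K * (184 * (I.K ^ 3 * I.N) + 1) ≤
      W ^ I.K * (185 * (I.K ^ 3 * I.N)) :=
    Nat.mul_le_mul (Nat.pow_le_pow_left hmW I.K) (by omega)
  linarith

end Enumerate

open Var Operand in
/-- Decide whether `P` contains a copy of `Q`. The cases `|Q| ≤ 1` and `P = ∅` are treated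
separately, since the bound on the running time leaves no room for the partition into chains. -/
def decideEmbedding : Cmd :=
  ite (.lt k one) (assign res 1) (ite (.lt n one) (assign res 0)
    (ite (.eq k one) (assign res 1) (decompose ⨾ enumerate)))

theorem decideEmbedding_cost {K N W t t' : ℕ} (hK : 2 ≤ K) (hN : 1 ≤ N) (hW : 1 ≤ W)
    (ht : t ≤ N * (100 * N * (W + 2) ^ 2 + 2) + 2)
    (ht' : t' ≤ W ^ K * (185 * (K ^ 3 * N)) + 24 * N + 8) :
    t + t' + 3 ≤ 1150 * max 1 (W ^ K * K ^ 3 * N ^ 2) := by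
  refine le_trans ?_ (Nat.mul_le_mul_left 1150 (le_max_right _ _))
  have hWK : W ^ 2 ≤ W ^ K := Nat.pow_le_pow_right hW hK
  have hfactors : 1 ≤ W ^ K * K ^ 3 := Nat.mul_pos (Nat.pow_pos hW) (Nat.pow_pos (by omega))
  have hNN : N ≤ N ^ 2 := Nat.le_self_pow two_ne_zero N
  have hpartition : (W + 2) ^ 2 * N ^ 2 ≤ 9 * (W ^ K * K ^ 3 * N ^ 2) := by
    calc (W + 2) ^ 2 * N ^ 2 ≤ (9 * W ^ 2) * 1 * N ^ 2 := by gcongr; nlinarith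
      _ ≤ (9 * W ^ K) * K ^ 3 * N ^ 2 := by gcongr; exact Nat.one_le_pow 3 K (by omega)
      _ = 9 * (W ^ K * K ^ 3 * N ^ 2) := by ring
  have henumerate : W ^ K * (K ^ 3 * N) ≤ W ^ K * K ^ 3 * N ^ 2 := by
    rw [← mul_assoc]
    gcongr
  have hlinear : 1 * N ≤ W ^ K * K ^ 3 * N ^ 2 := Nat.mul_le_mul hfactors hNN
  linarith

theorem WidthLE.pos {le : ℕ → ℕ → Prop} {N W : ℕ} (hW : WidthLE le N W) (hN : 0 < N) : 0 < W :=
  hW {0} (by simpa using hN) (by simp)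

theorem Input.hasSolution_of_le_one [Std.Refl I.qle] [Std.Refl I.le] (hK : I.K ≤ 1)
    (hN : I.K ≤ I.N) : I.HasSolution := by
  refine ⟨fun _ => 0, fun q hq => (Nat.zero_lt_of_lt hq).trans_le hN, fun q hq q' hq' => ?_⟩
  obtain rfl : q = q' := by omega
  exact iff_of_true (refl_of I.qle q) (refl_of I.le 0)

theorem Input.not_hasSolution (hK : 0 < I.K) (hN : I.N = 0) : ¬ I.HasSolution := by
  rintro ⟨s, hs, -⟩
  exact absurd (hs 0 hK) (by omega)

theorem decideEmbedding_spec {W : ℕ} [Std.Refl I.qle] [IsPartialOrder ℕ I.le]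
    (hW : WidthLE I.le I.N W) (hdig : ∀ q < I.K, h.arr .dig q = 0) :
    Sat I decideEmbedding h fun h' t => t ≤ 1150 * max 1 (W ^ I.K * I.K ^ 3 * I.N ^ 2) ∧
      (h'.var .res = 1 ∧ I.HasSolution ∨ h'.var .res = 0 ∧ ¬ I.HasSolution) := by
  have hmax : 1150 * 1 ≤ 1150 * max 1 (W ^ I.K * I.K ^ 3 * I.N ^ 2) :=
    Nat.mul_le_mul_left 1150 (le_max_left _ _)
  refine sat_ite (fun hK => ?_) fun hK => sat_ite (fun hN => ?_) fun hN =>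
    sat_ite (fun hK₁ => ?_) fun hK₁ => ?_
  · replace hK : I.K < 1 := hK
    exact sat_assign le_rfl ⟨by omega, .inl ⟨rfl, I.hasSolution_of_le_one hK.le (by omega)⟩⟩
  all_goals replace hK : ¬ I.K < 1 := hK
  · replace hN : I.N < 1 := hN
    exact sat_assign zero_le_one ⟨by omega, .inr ⟨rfl, I.not_hasSolution (by omega) (by omega)⟩⟩
  all_goals replace hN : ¬ I.N < 1 := hN
  · replace hK₁ : I.K = 1 := hK₁
    exact sat_assign le_rfl ⟨by omega, .inl ⟨rfl, I.hasSolution_of_le_one hK₁.le (by omega)⟩⟩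
  · replace hK₁ : I.K ≠ 1 := hK₁
    refine sat_seq <| (decompose_spec hW).imp fun h₁ t₁ hF₁ ⟨ht₁, hD⟩ => ?_
    have hdig₁ : h₁.arr .dig = h.arr .dig := hF₁.arr .dig
    rw [← hdig₁] at hdig
    exact (enumerate_spec (by omega) (by omega) hD hdig).imp fun h₂ t₂ _ ⟨ht₂, hres⟩ =>
      ⟨decideEmbedding_cost (by omega) (by omega) (hW.pos (by omega)) ht₁ ht₂, hres⟩

end Programs

/-! ### Numbered posets -/

section Posets

variable {X : Type*} [PartialOrder X] {n : ℕ} (e : Fin n ≃ X)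

/-- The order of a poset whose elements are numbered by `e`, as a relation between numbers. It is
extended by equality, so that it is a partial order of all natural numbers. -/
def NumberedLE (i j : ℕ) : Prop := i = j ∨ ∃ (hi : i < n) (hj : j < n), e ⟨i, hi⟩ ≤ e ⟨j, hj⟩

theorem numberedLE_iff {i j : ℕ} (hi : i < n) (hj : j < n) :
    NumberedLE e i j ↔ e ⟨i, hi⟩ ≤ e ⟨j, hj⟩ := by
  constructor
  · rintro (rfl | ⟨_, _, h⟩)
    exacts [le_rfl, h]
  · exact fun h => .inr ⟨hi, hj, h⟩

instance : IsPartialOrder ℕ (NumberedLE e) where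
  refl _ := .inl rfl
  trans := by
    rintro i j k (rfl | ⟨hi, hj, hij⟩) (rfl | ⟨hj', hk, hjk⟩)
    exacts [.inl rfl, .inr ⟨hj', hk, hjk⟩, .inr ⟨hi, hj, hij⟩, .inr ⟨hi, hk, hij.trans hjk⟩]
  antisymm := by
    rintro i j (rfl | ⟨hi, hj, hij⟩) (h | ⟨_, _, hji⟩)
    exacts [rfl, rfl, h.symm, congrArg Fin.val (e.injective (hij.antisymm hji))]

theorem widthLE_numberedLE {P : Type*} [Fintype P] [PartialOrder P]
    (eP : Fin (Fintype.card P) ≃ P) :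
    WidthLE (NumberedLE eP) (Fintype.card P) (posetWidth P) := by
  classical
  intro A hAN hA
  have hcard : ((A.attachFin hAN).map eP.toEmbedding).card = A.card := by simp
  rw [← hcard]
  refine Finset.le_sup (Finset.mem_filter.2 ⟨Finset.mem_univ _, ?_⟩)
  simp only [IsAntichain, Set.Pairwise, Finset.coe_map, Set.mem_image]
  rintro _ ⟨i, hi, rfl⟩ _ ⟨j, hj, rfl⟩ hne hle
  refine hA (Finset.mem_attachFin hAN |>.1 hi) (Finset.mem_attachFin hAN |>.1 hj) ?_
    ((numberedLE_iff eP i.2 j.2).2 hle)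
  exact fun h => hne (congrArg eP (Fin.ext h))

variable {Q P : Type*} [Fintype Q] [PartialOrder Q] [Fintype P] [PartialOrder P]
  (eQ : Fin (Fintype.card Q) ≃ Q) (eP : Fin (Fintype.card P) ≃ P) {b : ℕ}

/-- The orders of two posets with numbered elements. -/
def Input.ofPosets (hb : 16 * (Fintype.card Q + Fintype.card P + 1) ^ 2 ≤ 2 ^ b) :
    Input where
  b := b
  K := Fintype.card Q
  N := Fintype.card P
  qle := NumberedLE eQ
  le := NumberedLE eP
  word := hb

theorem Input.hasSolution_ofPosets_iff
    (hb : 16 * (Fintype.card Q + Fintype.card P + 1) ^ 2 ≤ 2 ^ b) :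
    (ofPosets eQ eP hb).HasSolution ↔ Nonempty (Q ↪o P) := by
  constructor
  · rintro ⟨s, hsN, hs⟩
    refine ⟨.ofMapLEIff (fun q => eP ⟨s (eQ.symm q), hsN _ (eQ.symm q).2⟩) fun q q' => ?_⟩
    have hq : NumberedLE eQ (eQ.symm q) (eQ.symm q') ↔
        NumberedLE eP (s (eQ.symm q)) (s (eQ.symm q')) := hs _ (eQ.symm q).2 _ (eQ.symm q').2
    rw [numberedLE_iff eQ (eQ.symm q).2 (eQ.symm q').2,
      numberedLE_iff eP (hsN _ (eQ.symm q).2) (hsN _ (eQ.symm q').2)] at hq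
    simpa using hq.symm
  · rintro ⟨f⟩
    let s (i : ℕ) : ℕ := if hi : i < Fintype.card Q then eP.symm (f (eQ ⟨i, hi⟩)) else 0
    have hs (i : ℕ) (hi : i < Fintype.card Q) : s i = eP.symm (f (eQ ⟨i, hi⟩)) := dif_pos hi
    refine ⟨s, fun i (hi : i < Fintype.card Q) => (hs i hi).trans_lt (Fin.is_lt _),
      fun i (hi : i < Fintype.card Q) j (hj : j < Fintype.card Q) => ?_⟩
    rw [hs i hi, hs j hj]
    calc NumberedLE eQ i j ↔ eQ ⟨i, hi⟩ ≤ eQ ⟨j, hj⟩ := numberedLE_iff eQ hi hj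
      _ ↔ eP (eP.symm (f (eQ ⟨i, hi⟩))) ≤ eP (eP.symm (f (eQ ⟨j, hj⟩))) := by simp
      _ ↔ _ := (numberedLE_iff eP (Fin.is_lt _) (Fin.is_lt _)).symm

theorem mul_add_inj {i i' j j' : Fin n} (h : (i * n + j : ℕ) = i' * n + j') : i = i' ∧ j = j' := by
  refine Prod.mk.inj (finProdFinEquiv.injective (Fin.ext ?_))
  simp only [finProdFinEquiv_apply_val]
  linarith

theorem mul_add_lt (i j : Fin n) : (i * n + j : ℕ) < n * n := by
  nlinarith [i.2, j.2]

open Classical in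
theorem mem_posetPairInput_left (i j : Fin (Fintype.card Q)) :
    (posetPairInput eQ eP).mem (i * Fintype.card Q + j) = if eQ i ≤ eQ j then 1 else 0 := by
  have := mul_add_lt i j
  refine if_congr ⟨?_, fun h => .inl ⟨i, j, rfl, h⟩⟩ rfl rfl
  rintro (⟨i', j', h, hle⟩ | ⟨i', j', h, -⟩)
  · obtain ⟨rfl, rfl⟩ := mul_add_inj h
    exact hle
  · omega

open Classical in
theorem mem_posetPairInput_right (i j : Fin (Fintype.card P)) :
    (posetPairInput eQ eP).mem (Fintype.card Q * Fintype.card Q + i * Fintype.card P + j) =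
      if eP i ≤ eP j then 1 else 0 := by
  refine if_congr ⟨?_, fun h => .inr ⟨i, j, rfl, h⟩⟩ rfl rfl
  rintro (⟨i', j', h, -⟩ | ⟨i', j', h, hle⟩)
  · have := mul_add_lt i' j'
    omega
  · obtain ⟨rfl, rfl⟩ := mul_add_inj (i := i) (i' := i') (j := j) (j' := j') (by omega)
    exact hle

theorem mem_posetPairInput_of_le {a : ℕ}
    (ha : Fintype.card Q * Fintype.card Q + Fintype.card P * Fintype.card P ≤ a) :
    (posetPairInput eQ eP).mem a = 0 := by
  refine if_neg ?_
  rintro (⟨i, j, rfl, -⟩ | ⟨i, j, rfl, -⟩) <;> have := mul_add_lt i j <;> omega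

/-- Compute the constants that the machine holds in the registers `4` to `6`. -/
def preamble : Prog :=
  .seq (.instr (.const 6 1)) (.seq (.instr (.mul 4 0 0)) (.seq (.instr (.mul 5 1 1))
    (.instr (.add 5 4 5))))

/-- A program for the embedding problem. -/
def embeddingProg : Prog :=
  .seq preamble (.seq decideEmbedding.prog (.instr (.copy 0 Var.res.reg)))

open Classical in
theorem sim_ofPosets (hb : 16 * (Fintype.card Q + Fintype.card P + 1) ^ 2 ≤ 2 ^ b)
    {s : State} (hmem : s.mem = (posetPairInput eQ eP).mem)
    (hk : s.reg 0 = Fintype.card Q) (hn : s.reg 1 = Fintype.card P)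
    (hfour : s.reg 4 = Fintype.card Q * Fintype.card Q)
    (hfive : s.reg 5 = Fintype.card Q * Fintype.card Q + Fintype.card P * Fintype.card P)
    (hone : s.reg 6 = 1) (hvar : ∀ r, 7 ≤ r → s.reg r = 0) :
    Sim (.ofPosets eQ eP hb) ⟨fun _ => 0, fun _ _ => 0⟩ s where
  reg_operand
    | .var z => hvar z.reg (Nat.le_add_right 7 _)
    | .k => hk
    | .n => hn
    | .one => hone
  reg_four := hfour
  reg_five := hfive
  mem_arr r i := by
    rw [hmem]
    refine mem_posetPairInput_of_le eQ eP ?_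
    rw [Nat.add_assoc]
    exact Nat.le_add_right _ _
  mem_qle i hi j hj := by
    rw [hmem]
    exact (mem_posetPairInput_left eQ eP ⟨i, hi⟩ ⟨j, hj⟩).trans
      (if_congr (numberedLE_iff eQ hi hj).symm rfl rfl)
  mem_le i hi j hj := by
    rw [hmem]
    exact (mem_posetPairInput_right eQ eP ⟨i, hi⟩ ⟨j, hj⟩).trans
      (if_congr (numberedLE_iff eP hi hj).symm rfl rfl)
  var_le _ := Nat.zero_le _
  arr_le _ _ := Nat.zero_le _

theorem exec_preamble (hb : 16 * (Fintype.card Q + Fintype.card P + 1) ^ 2 ≤ 2 ^ b) :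
    ∃ s, Exec b preamble (posetPairInput eQ eP) s 4 ∧
    Sim (.ofPosets eQ eP hb) ⟨fun _ => 0, fun _ _ => 0⟩ s := by
  have hword : Fintype.card Q * Fintype.card Q + Fintype.card P * Fintype.card P + 1 < 2 ^ b := by
    nlinarith
  refine ⟨_, .seq (exec_setReg (dst := 6) (e := 1) rfl (by omega)) <| .seq (exec_setReg
    (dst := 4) (e := Fintype.card Q * Fintype.card Q) (by simp [Instr.step, posetPairInput])
    (by omega)) <| .seq (exec_setReg (dst := 5) (e := Fintype.card P * Fintype.card P)
    (by simp [Instr.step, posetPairInput]) (by omega)) <| exec_setReg (dst := 5)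
    (e := Fintype.card Q * Fintype.card Q + Fintype.card P * Fintype.card P)
    (by simp [Instr.step]) (by omega), ?_⟩
  refine sim_ofPosets eQ eP hb rfl (by simp [posetPairInput]) (by simp [posetPairInput])
    (by simp) (by simp) (by simp) fun r hr => ?_
  simp only [posetPairInput]
  grind

open Classical in
theorem exec_embeddingProg
    (hb : 16 * (Fintype.card Q + Fintype.card P + 1) ^ 2 ≤ 2 ^ b) :
    ∃ s t, Exec b embeddingProg (posetPairInput eQ eP) s t ∧
      s.reg 0 = (if Nonempty (Q ↪o P) then 1 else 0) ∧
      t ≤ 1200 * max 1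
        (posetWidth P ^ Fintype.card Q * Fintype.card Q ^ 3 * Fintype.card P ^ 2) := by
  obtain ⟨s, hexec, hsim⟩ := exec_preamble eQ eP hb
  have : Std.Refl (Input.ofPosets eQ eP hb).qle := inferInstanceAs (Std.Refl (NumberedLE eQ))
  have : IsPartialOrder ℕ (Input.ofPosets eQ eP hb).le :=
    inferInstanceAs (IsPartialOrder ℕ (NumberedLE eP))
  obtain ⟨s', t, h', hexec', hsim', -, ht, hres⟩ :=
    decideEmbedding_spec (widthLE_numberedLE eP) (fun _ _ => rfl) s hsim
  have hanswer : h'.var .res = if Nonempty (Q ↪o P) then 1 else 0 := by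
    rw [Input.hasSolution_ofPosets_iff] at hres
    split_ifs <;> grind
  refine ⟨_, _, .seq hexec <| .seq hexec' <| exec_setReg (dst := 0) (e := h'.var .res) ?_
    (Input.lt_word_of_le_bound (hsim'.var_le _)), ?_, ?_⟩
  · exact congrArg (s'.setReg b 0) (hsim'.reg_operand (.var .res))
  · exact (Function.update_self 0 (h'.var .res) s'.reg).trans hanswer
  · replace ht : t ≤ 1150 * max 1
      (posetWidth P ^ Fintype.card Q * Fintype.card Q ^ 3 * Fintype.card P ^ 2) := ht
    omega

end Posets

end PosetEmbedding

open Classical in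
theorem mainTheorem2 :
    ∃ (prog : WordRAM.Prog) (c C : ℕ),
      ∀ (Q P : Type) [Fintype Q] [PartialOrder Q] [Fintype P] [PartialOrder P]
        (eQ : Fin (Fintype.card Q) ≃ Q) (eP : Fin (Fintype.card P) ≃ P)
        (b : ℕ), c * (Fintype.card Q + Fintype.card P + 1) ^ 2 ≤ 2 ^ b →
        ∃ (s : WordRAM.State) (t : ℕ),
          WordRAM.Exec b prog (WordRAM.posetPairInput eQ eP) s t ∧
          s.reg 0 = (if Nonempty (Q ↪o P) then 1 else 0) ∧
          t ≤ C * max 1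
            (posetWidth P ^ Fintype.card Q * Fintype.card Q ^ 3 * Fintype.card P ^ 2) :=
  ⟨PosetEmbedding.embeddingProg, 16, 1200, fun _ _ _ _ _ _ eQ eP _ hb =>
    PosetEmbedding.exec_embeddingProg eQ eP hb⟩
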